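/- Let $X$ and $Y$ be metric spaces of bounded geometry, i.e. for every $R\ge 0$ there is $N_R\in\mathbb N$ such that every ball of radius $R$ has at most $N_R$ elements. Let $\mathcal H_X,\mathcal H_Y$ be separable infinite-dimensional complex Hilbert spaces. For a bounded operator $T$ on $\ell^2(X,\mathcal H_X)$ and $x,y\in X$, let $T_{xy}\in\mathcal B(\mathcal H_X)$, $T_{xy}v=(T(\delta_y\otimes v))(x)$, be its matrix coefficients. Let $\mathbb C_s[X]$ be the $*$-algebra of all bounded operators $T$ on $\ell^2(X,\mathcal H_X)$ such that (i) there is $S>0$ with $T_{xy}=0$ whenever $d(x,y)\ge S$, and (ii) there is a finite-dimensional subspace $V\subseteq\mathcal H_X$ such that for all $x,y\in X$, $T_{xy}\in\mathcal B(V)$ (that is, $T_{xy}$ maps $V$ into $V$ and vanishes on $V^\perp$). Let $C^*_s(X)$, the stable uniform Roe algebra, be the operator norm closure of $\mathbb C_s[X]$ in $\mathcal B(\ell^2(X,\mathcal H_X))$. Define $\mathbb C_s[Y]$ and $C^*_s(Y)$ in the same way from $\mathcal H_Y$. A map $f$ between metric spaces is uniformly expansive if for all $R>0$ there is $S>0$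 such that $d(x_1,x_2)\le R$ implies $d(f(x_1),f(x_2))\le S$. The spaces $X$ and $Y$ are coarsely equivalent if there are uniformly expansive maps $f:X\to Y$ and $g:Y\to X$ such that $d(f(g(y)),y)$ is bounded over $y\in Y$ and $d(g(f(x)),x)$ is bounded over $x\in X$. The space $X$ has (Yu's) property A if for all $r,\varepsilon>0$ there are finite sets $A_x\subseteq X\times\{1,2,3,\dots\}$ $(x\in X)$ such that $(x,1)\in A_x$ for all $x$; $A_x\cap A_y\ne\emptyset$ and $\#(A_x\mathbin{\triangle}A_y)/\#(A_x\cap A_y)<\varepsilon$ whenever $d(x,y)\le r$; and there is $R>0$ such that $d(z,w)\le R$ whenever $(z,m),(w,n)\in A_x$ for some $x$. Then: (1) If $X$ and $Y$ have property A and there is a $*$-isomorphism $C^*_s(X)\to C^*_s(Y)$, then $X$ and $Y$ are coarsely equivalent. (2) If there is a $*$-isomorphism $\mathbb C_s[X]\to\mathbb C_s[Y]$, then $X$ and $Y$ are coarsely equivalent. -/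

import Mathlib

/-- Bounded geometry: for every radius, the cardinality of balls of that radius is finite and
uniformly bounded. -/
def BoundedGeometry (X : Type*) [MetricSpace X] : Prop :=
  ∀ R : ℝ, 0 ≤ R → ∃ N : ℕ, ∀ x : X, (Metric.closedBall x R).encard ≤ (N : ℕ∞)

/-- A (not necessarily continuous) map is uniformly expansive if it sends points at bounded
distance to points at bounded distance. -/
def UniformlyExpansive {X Y : Type*} [MetricSpace X] [MetricSpace Y] (f : X → Y) : Prop :=
  ∀ R : ℝ, 0 < R → ∃ S : ℝ, 0 < S ∧ ∀ x₁ x₂ : X, dist x₁ x₂ ≤ R → dist (f x₁) (f x₂) ≤ S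

/-- Two maps are close if they are at bounded distance from each other. -/
def AreClose {X Y : Type*} [MetricSpace Y] (f g : X → Y) : Prop :=
  ∃ C : ℝ, 0 < C ∧ ∀ x : X, dist (f x) (g x) ≤ C

/-- Coarse equivalence of metric spaces. -/
def CoarselyEquivalent (X Y : Type*) [MetricSpace X] [MetricSpace Y] : Prop :=
  ∃ (f : X → Y) (g : Y → X), UniformlyExpansive f ∧ UniformlyExpansive g ∧
    AreClose (f ∘ g) id ∧ AreClose (g ∘ f) id

open Classical in
/-- Yu's property A: for all `r, ε > 0` there are finite sets `A x ⊆ X × {1, 2, …}` with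
`(x, 1) ∈ A x`, with `#(A x ∆ A y) / #(A x ∩ A y) < ε` whenever `dist x y ≤ r`
(the inequality is multiplied out, and so forces `A x ∩ A y` to be non-empty), and
such that the projections of the sets `A x` to `X` have uniformly bounded diameter. -/
def PropertyA (X : Type*) [MetricSpace X] : Prop :=
  ∀ r ε : ℝ, 0 < r → 0 < ε → ∃ A : X → Finset (X × ℕ+),
    (∀ x, (x, 1) ∈ A x) ∧
    (∀ x y, dist x y ≤ r →
      ((symmDiff (A x) (A y)).card : ℝ) < ε * ((A x ∩ A y).card : ℝ)) ∧
    ∃ R : ℝ, 0 < R ∧ ∀ x, ∀ p ∈ A x, ∀ q ∈ A x, dist p.1 q.1 ≤ R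

/-- The Hilbert space `ℓ²(X, H)` of square summable functions on `X` with values in `H`. -/
abbrev L2Fun (X H : Type*) [NormedAddCommGroup H] : Type _ := lp (fun _ : X => H) 2

namespace RoeAlgebra

section

variable {X H : Type*} [NormedAddCommGroup H] [InnerProductSpace ℂ H]

open Classical in
/-- The matrix coefficient `T_{xy} : H → H` of a bounded operator `T` on `ℓ²(X, H)`, that is
`v ↦ (T (δ_y ⊗ v)) (x)`. -/
noncomputable def entry (T : L2Fun X H →L[ℂ] L2Fun X H) (x y : X) : H →L[ℂ] H :=
  (lp.evalCLM ℂ (fun _ : X => H) 2 x) ∘L T ∘L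
    (lp.singleContinuousLinearMap ℂ (fun _ : X => H) 2 y)

/-- Finite propagation: the matrix coefficients vanish far from the diagonal. -/
def FinitePropagation [MetricSpace X] (T : L2Fun X H →L[ℂ] L2Fun X H) : Prop :=
  ∃ S : ℝ, 0 < S ∧ ∀ x y : X, S ≤ dist x y → entry T x y = 0

/-- `B(V)`, for a subspace `V` of `H`, as a subset of `B(H)`: the operators which map `V` to `V`
and vanish on the orthogonal complement of `V`. -/
def MemB (V : Submodule ℂ H) (a : H →L[ℂ] H) : Prop :=
  (∀ v ∈ V, a v ∈ V) ∧ ∀ v ∈ Vᗮ, a v = 0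

/-- All matrix coefficients lie in `B(V)` for one finite dimensional subspace `V` of `H`. -/
def UniformlyFiniteEntries (T : L2Fun X H →L[ℂ] L2Fun X H) : Prop :=
  ∃ V : Submodule ℂ H, FiniteDimensional ℂ V ∧ ∀ x y : X, MemB V (entry T x y)

theorem MemB.apply_mem {V : Submodule ℂ H} [FiniteDimensional ℂ V] {a : H →L[ℂ] H}
    (h : MemB V a) (v : H) : a v ∈ V := by
  obtain ⟨p, hp, q, hq, rfl⟩ := V.exists_add_mem_mem_orthogonal v
  rw [map_add, h.2 q hq, add_zero]
  exact h.1 p hp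

theorem MemB.mono {V W : Submodule ℂ H} [FiniteDimensional ℂ V] {a : H →L[ℂ] H}
    (h : MemB V a) (hVW : V ≤ W) : MemB W a :=
  ⟨fun v _ => hVW (h.apply_mem v), fun v hv => h.2 v (Submodule.orthogonal_le hVW hv)⟩

theorem entry_add (T U : L2Fun X H →L[ℂ] L2Fun X H) (x y : X) :
    entry (T + U) x y = entry T x y + entry U x y := rfl

theorem entry_zero (x y : X) : entry (0 : L2Fun X H →L[ℂ] L2Fun X H) x y = 0 := rfl

theorem entry_smul (c : ℂ) (T : L2Fun X H →L[ℂ] L2Fun X H) (x y : X) :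
    entry (c • T) x y = c • entry T x y := rfl

theorem hasSum_entry_mul (T U : L2Fun X H →L[ℂ] L2Fun X H) (x y : X) (v : H) :
    HasSum (fun z => entry T x z (entry U z y v)) (entry (T * U) x y v) := by
  classical
  have h := lp.hasSum_single (p := 2) (by simp)
    (U (lp.singleContinuousLinearMap ℂ (fun _ : X => H) 2 y v))
  have h2 := h.mapL ((lp.evalCLM ℂ (fun _ : X => H) 2 x) ∘L T)
  exact h2

theorem inner_entry_star [CompleteSpace H] (T : L2Fun X H →L[ℂ] L2Fun X H) (x y : X) (v w : H) :
    inner ℂ (entry (star T) x y v) w = inner ℂ v (entry T y x w) := by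
  classical
  have h1 := lp.inner_single_right (𝕜 := ℂ) (G := fun _ : X => H) x w
    ((star T) (lp.single 2 y v))
  have h2 := lp.inner_single_left (𝕜 := ℂ) (G := fun _ : X => H) y v (T (lp.single 2 x w))
  rw [ContinuousLinearMap.star_eq_adjoint, ContinuousLinearMap.adjoint_inner_left] at h1
  have h3 := h1.symm.trans h2
  rw [← ContinuousLinearMap.star_eq_adjoint] at h3
  exact h3

theorem FinitePropagation.mul [MetricSpace X] {T U : L2Fun X H →L[ℂ] L2Fun X H}
    (hT : FinitePropagation T) (hU : FinitePropagation U) : FinitePropagation (T * U) := by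
  obtain ⟨S, hS, hT⟩ := hT
  obtain ⟨S', hS', hU⟩ := hU
  refine ⟨S + S', by positivity, fun x y hxy => ?_⟩
  ext v
  refine (hasSum_entry_mul T U x y v).unique ?_
  rw [zero_apply]
  convert hasSum_zero with z
  by_cases h : S ≤ dist x z
  · simp [hT x z h]
  · have : S' ≤ dist z y := by linarith [dist_triangle x z y]
    simp [hU z y this]

theorem UniformlyFiniteEntries.mul {T U : L2Fun X H →L[ℂ] L2Fun X H}
    (hT : UniformlyFiniteEntries T) (hU : UniformlyFiniteEntries U) :
    UniformlyFiniteEntries (T * U) := by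
  obtain ⟨V, hV, hT⟩ := hT
  obtain ⟨W, hW, hU⟩ := hU
  refine ⟨V ⊔ W, inferInstance, fun x y => ⟨fun v _ => ?_, fun v hv => ?_⟩⟩
  · refine (Submodule.closed_of_finiteDimensional (V ⊔ W)).mem_of_tendsto
      (hasSum_entry_mul T U x y v) (Filter.Eventually.of_forall fun s => ?_)
    exact Submodule.sum_mem _ fun z _ => le_sup_left (α := Submodule ℂ H) ((hT x z).apply_mem _)
  · refine (hasSum_entry_mul T U x y v).unique ?_
    convert hasSum_zero with z
    rw [(hU z y).2 v (Submodule.orthogonal_le le_sup_right hv), map_zero]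

theorem FinitePropagation.star_mem [CompleteSpace H] [MetricSpace X]
    {T : L2Fun X H →L[ℂ] L2Fun X H} (hT : FinitePropagation T) : FinitePropagation (star T) := by
  obtain ⟨S, hS, hT⟩ := hT
  refine ⟨S, hS, fun x y hxy => ?_⟩
  ext v
  refine ext_inner_right ℂ fun w => ?_
  rw [inner_entry_star, hT y x (by rwa [dist_comm])]
  simp

theorem UniformlyFiniteEntries.star_mem [CompleteSpace H]
    {T : L2Fun X H →L[ℂ] L2Fun X H} (hT : UniformlyFiniteEntries T) :
    UniformlyFiniteEntries (star T) := by
  obtain ⟨V, hV, hT⟩ := hT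
  refine ⟨V, hV, fun x y => ⟨fun v _ => ?_, fun v hv => ?_⟩⟩
  · rw [← Submodule.orthogonal_orthogonal V, Submodule.mem_orthogonal']
    intro w hw
    rw [inner_entry_star, (hT y x).2 w hw, inner_zero_right]
  · refine ext_inner_right ℂ fun w => ?_
    rw [inner_entry_star, inner_zero_left]
    exact Submodule.inner_left_of_mem_orthogonal ((hT y x).apply_mem w) hv

end

end RoeAlgebra

open RoeAlgebra in
/-- The algebra `ℂ_s[X]`: the `*`-algebra of all finite propagation operators `T` on `ℓ²(X, H)`
for which there is a finite dimensional subspace `V` of `H` with `T_{xy} ∈ B(V)` for all `x, y`. -/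
noncomputable def algStableUniformRoe (X H : Type*) [MetricSpace X] [NormedAddCommGroup H]
    [InnerProductSpace ℂ H] [CompleteSpace H] :
    NonUnitalStarSubalgebra ℂ (L2Fun X H →L[ℂ] L2Fun X H) where
  carrier := {T | FinitePropagation T ∧ UniformlyFiniteEntries T}
  zero_mem' := ⟨⟨1, one_pos, fun _ _ _ => rfl⟩, ⟨⊥, inferInstance, fun x y => by
    rw [entry_zero]; exact ⟨fun _ _ => rfl, fun _ _ => rfl⟩⟩⟩
  add_mem' := by
    rintro T U ⟨⟨S, hS, hT⟩, V, hV, hTV⟩ ⟨⟨S', hS', hU⟩, W, hW, hUW⟩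
    refine ⟨⟨max S S', lt_max_of_lt_left hS, fun x y h => ?_⟩, V ⊔ W, inferInstance,
      fun x y => ?_⟩
    · rw [entry_add, hT x y (le_trans (le_max_left _ _) h),
        hU x y (le_trans (le_max_right _ _) h), add_zero]
    · have h1 := (hTV x y).mono (W := V ⊔ W) le_sup_left
      have h2 := (hUW x y).mono (W := V ⊔ W) le_sup_right
      rw [entry_add]
      refine ⟨fun v hv => Submodule.add_mem _ (h1.1 v hv) (h2.1 v hv), fun v hv => ?_⟩
      rw [add_apply, h1.2 v hv, h2.2 v hv, add_zero]
  smul_mem' := by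
    rintro c T ⟨⟨S, hS, hT⟩, V, hV, hTV⟩
    refine ⟨⟨S, hS, fun x y h => ?_⟩, V, hV, fun x y => ?_⟩
    · rw [entry_smul, hT x y h, smul_zero]
    · rw [entry_smul]
      refine ⟨fun v hv => Submodule.smul_mem _ _ ((hTV x y).1 v hv), fun v hv => ?_⟩
      rw [smul_apply, (hTV x y).2 v hv, smul_zero]
  mul_mem' := fun hT hU => ⟨hT.1.mul hU.1, hT.2.mul hU.2⟩
  star_mem' := fun hT => ⟨hT.1.star_mem, hT.2.star_mem⟩

/-- The stable uniform Roe algebra `C*_s(X)`: the operator norm closure of `ℂ_s[X]` in the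
bounded operators on `ℓ²(X, H)`. -/
noncomputable def stableUniformRoe (X H : Type*) [MetricSpace X] [NormedAddCommGroup H]
    [InnerProductSpace ℂ H] [CompleteSpace H] :
    NonUnitalStarSubalgebra ℂ (L2Fun X H →L[ℂ] L2Fun X H) :=
  (algStableUniformRoe X H).topologicalClosure

/-!
A `*`-isomorphism between (completed or uncompleted) stable uniform Roe algebras is conjugation by
a unitary `U : ℓ²(X, HX) → ℓ²(Y, HY)`, because the algebras contain the rank one operators between
vectors of the form `δ_x ⊗ a` (`IsStarIsoOn.exists_unitary`). From then on only two facts matter: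
conjugation by `U` maps `ℂ_s[X]` into `C*_s(Y)`, and conjugation by `U*` maps `ℂ_s[Y]` into
`C*_s(X)`.

Fix unit vectors `v` and `w` of the coefficient spaces. A coarse equivalence `f : X → Y` is obtained
by picking for each `x` a point `f x` at which `U (δ_x ⊗ v)` has a large coefficient, and `g` is
found in the same way from `U*` and `w`. This rests on three points.

* Uniformity (`exists_uniform_quasiLocal`). If operators `T A` are indexed by the subsets `A` of a
  set, belong to `C*_s(Y)` and depend countably additively on `A`, then they are quasi-local with
  the same constants. This follows from Baire's theorem on the compact space of subsets. It is
  applied to the conjugates of the band operators `∑ (δ_x ⊗ a) (δ_y ⊗ b)*`, where `(x, y)` ranges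
  over a set of pairs of points at bounded distance.
* Existence of large coefficients (`exists_coefficient_lower_bound`, `exists_large_coefficient`).
  Since `U (1 ⊗ v v*) U*` is almost an operator with coefficients in a finite dimensional space,
  one of finitely many families of coefficients `t y = ⟨w i, U (δ_x ⊗ v) y⟩` carries a fixed
  proportion of the mass. By uniformity, for all choices of signs, the vectors
  `U* (∑ ± t y • δ_y ⊗ w i)` are close to one subspace, of dimension bounded independently of `x`.
  For random signs the expected square of the norm of the projection to a space of dimension `M` is
  at most `M * sup |t y|²`, so that `sup |t y|` is bounded below.
* Control of large coefficients (`ConjMapsInto.exists_dist_lt`). The operator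
  `(δ_{x₁} ⊗ a) (δ_{x₂} ⊗ b)*` is conjugate to the rank one operator given by `U (δ_{x₁} ⊗ a)` and
  `U (δ_{x₂} ⊗ b)`. If `x₁` and `x₂` are close, then by uniformity the points at which these two
  vectors have large coefficients are close. With `a = b = v` this says that `f` is
  uniformly expansive, and applied to `U*` at `x₁ = x₂ = f x` it says that `g (f x)` is close
  to `x`.
-/

open InnerProductSpace

/-! ### Implementing isomorphisms by unitaries -/

section Implementation

variable {K L : Type*} [NormedAddCommGroup K] [InnerProductSpace ℂ K]
  [NormedAddCommGroup L] [InnerProductSpace ℂ L]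

theorem mul_rankOne (T : K →L[ℂ] K) (x y : K) : T * rankOne ℂ x y = rankOne ℂ (T x) y := by
  ext z; simp

theorem eq_zero_of_forall_dense_span {S : Set K} (hS : Dense (Submodule.span ℂ S : Set K))
    {T : K →L[ℂ] L} (h : ∀ s ∈ S, T s = 0) : T = 0 := by
  refine ContinuousLinearMap.ext_on hS fun s hs => ?_
  simpa using h s hs

variable [CompleteSpace K] [CompleteSpace L]

theorem rankOne_mul (T : K →L[ℂ] K) (x y : K) :
    rankOne ℂ x y * T = rankOne ℂ x (star T y) := by
  ext z
  simp [ContinuousLinearMap.star_eq_adjoint, ContinuousLinearMap.adjoint_inner_left]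

theorem star_rankOne (x y : K) : star (rankOne ℂ x y) = rankOne ℂ y x := by
  rw [ContinuousLinearMap.star_eq_adjoint]
  exact InnerProductSpace.adjoint_rankOne x y

/-- The vectors `x` for which the rank one operator `x ⊗ z*` lies in `A`. This subspace is
invariant under `A`. -/
def rankOneVectors (A : NonUnitalStarSubalgebra ℂ (K →L[ℂ] K)) (z : K) : Submodule ℂ K where
  carrier := {x | rankOne ℂ x z ∈ A}
  zero_mem' := by simp [zero_mem]
  add_mem' := by
    intro x y hx hy
    simpa using add_mem hx hy
  smul_mem' := by
    intro c x hx
    simpa using SMulMemClass.smul_mem c hx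

theorem mem_rankOneVectors {A : NonUnitalStarSubalgebra ℂ (K →L[ℂ] K)} {z x : K} :
    x ∈ rankOneVectors A z ↔ rankOne ℂ x z ∈ A := Iff.rfl

/-- The map `φ` restricts to an injective `*`-homomorphism from `A` to `B`, with inverse `ψ`.
Both maps are defined on all operators, with arbitrary values outside `A` and `B`, so that no
subtypes are involved. -/
structure IsStarIsoOn (A : NonUnitalStarSubalgebra ℂ (K →L[ℂ] K))
    (B : NonUnitalStarSubalgebra ℂ (L →L[ℂ] L))
    (φ : (K →L[ℂ] K) → (L →L[ℂ] L)) (ψ : (L →L[ℂ] L) → (K →L[ℂ] K)) : Prop where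
  map_mem : ∀ a ∈ A, φ a ∈ B
  map_add : ∀ a ∈ A, ∀ b ∈ A, φ (a + b) = φ a + φ b
  map_smul : ∀ (c : ℂ), ∀ a ∈ A, φ (c • a) = c • φ a
  map_mul : ∀ a ∈ A, ∀ b ∈ A, φ (a * b) = φ a * φ b
  map_star : ∀ a ∈ A, φ (star a) = star (φ a)
  left_inv : ∀ a ∈ A, ψ (φ a) = a

open Classical in
theorem exists_isStarIsoOn {A : NonUnitalStarSubalgebra ℂ (K →L[ℂ] K)}
    {B : NonUnitalStarSubalgebra ℂ (L →L[ℂ] L)} (Φ : A ≃⋆ₐ[ℂ] B) :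
    ∃ φ ψ, IsStarIsoOn A B φ ψ ∧ IsStarIsoOn B A ψ φ := by
  let φ : (K →L[ℂ] K) → (L →L[ℂ] L) := fun a => if h : a ∈ A then (Φ.toFun ⟨a, h⟩).1 else 0
  let ψ : (L →L[ℂ] L) → (K →L[ℂ] K) := fun b => if h : b ∈ B then (Φ.invFun ⟨b, h⟩).1 else 0
  have hφ : ∀ a : A, φ a.1 = (Φ.toFun a).1 := fun a => dif_pos a.2
  have hψ : ∀ b : B, ψ b.1 = (Φ.invFun b).1 := fun b => dif_pos b.2
  have hl : ∀ a : A, Φ.invFun (Φ.toFun a) = a := Φ.left_inv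
  have hr : ∀ b : B, Φ.toFun (Φ.invFun b) = b := Φ.right_inv
  have hmul : ∀ a b : A, (Φ.toFun (a * b)).1 = (Φ.toFun a).1 * (Φ.toFun b).1 :=
    fun a b => congrArg Subtype.val (Φ.map_mul' a b)
  have hadd : ∀ a b : A, (Φ.toFun (a + b)).1 = (Φ.toFun a).1 + (Φ.toFun b).1 :=
    fun a b => congrArg Subtype.val (Φ.map_add' a b)
  have hsmul : ∀ (c : ℂ) (a : A), (Φ.toFun (c • a)).1 = c • (Φ.toFun a).1 :=
    fun c a => congrArg Subtype.val (Φ.map_smul' c a)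
  have hstar : ∀ a : A, (Φ.toFun (star a)).1 = star (Φ.toFun a).1 :=
    fun a => congrArg Subtype.val (Φ.map_star' a)
  have h1 : IsStarIsoOn A B φ ψ :=
    { map_mem := fun a ha => by rw [hφ ⟨a, ha⟩]; exact (Φ.toFun _).2
      map_add := fun a ha b hb => by
        rw [hφ ⟨a, ha⟩, hφ ⟨b, hb⟩, ← hadd]; exact hφ (⟨a, ha⟩ + ⟨b, hb⟩)
      map_smul := fun c a ha => by
        rw [hφ ⟨a, ha⟩, ← hsmul]; exact hφ (c • ⟨a, ha⟩)
      map_mul := fun a ha b hb => by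
        rw [hφ ⟨a, ha⟩, hφ ⟨b, hb⟩, ← hmul]; exact hφ (⟨a, ha⟩ * ⟨b, hb⟩)
      map_star := fun a ha => by
        rw [hφ ⟨a, ha⟩, ← hstar]; exact hφ (star ⟨a, ha⟩)
      left_inv := fun a ha => by rw [hφ ⟨a, ha⟩, hψ, hl] }
  have hright : ∀ b ∈ B, φ (ψ b) = b := fun b hb => by rw [hψ ⟨b, hb⟩, hφ, hr]
  have hmem : ∀ b ∈ B, ψ b ∈ A := fun b hb => by rw [hψ ⟨b, hb⟩]; exact (Φ.invFun _).2
  have hinj : ∀ a ∈ A, ∀ a' ∈ A, φ a = φ a' → a = a' := fun a ha a' ha' h => by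
    rw [← h1.left_inv a ha, h, h1.left_inv a' ha']
  refine ⟨φ, ψ, h1, hmem, fun a ha b hb => ?_, fun c a ha => ?_, fun a ha b hb => ?_,
    fun a ha => ?_, hright⟩
  · refine hinj _ (hmem _ (add_mem ha hb)) _ (add_mem (hmem a ha) (hmem b hb)) ?_
    rw [h1.map_add _ (hmem a ha) _ (hmem b hb), hright _ ha, hright _ hb,
      hright _ (add_mem ha hb)]
  · refine hinj _ (hmem _ (B.smul_mem' c ha)) _ (A.smul_mem' c (hmem a ha)) ?_
    rw [h1.map_smul c _ (hmem a ha), hright _ ha, hright _ (B.smul_mem' c ha)]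
  · refine hinj _ (hmem _ (mul_mem ha hb)) _ (mul_mem (hmem a ha) (hmem b hb)) ?_
    rw [h1.map_mul _ (hmem a ha) _ (hmem b hb), hright _ ha, hright _ hb,
      hright _ (mul_mem ha hb)]
  · refine hinj _ (hmem _ (star_mem ha)) _ (star_mem (hmem a ha)) ?_
    rw [h1.map_star _ (hmem a ha), hright _ ha, hright _ (star_mem ha)]

section IsStarIsoOn

variable {A : NonUnitalStarSubalgebra ℂ (K →L[ℂ] K)} {B : NonUnitalStarSubalgebra ℂ (L →L[ℂ] L)}
  {φ : (K →L[ℂ] K) → (L →L[ℂ] L)} {ψ : (L →L[ℂ] L) → (K →L[ℂ] K)}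

/-- The image of a rank one projection under a `*`-isomorphism is a rank one projection, because
it is a minimal projection of an algebra that contains sufficiently many rank one operators. -/
theorem IsStarIsoOn.exists_map_rankOne_eq_rankOne (hφ : IsStarIsoOn A B φ ψ)
    (hψ : IsStarIsoOn B A ψ φ) {S' : Set L} (hS' : Dense (Submodule.span ℂ S' : Set L))
    (hB : ∀ s ∈ S', ∀ t ∈ S', rankOne ℂ s t ∈ B) {z : K} (hz : ‖z‖ = 1)
    (hzA : rankOne ℂ z z ∈ A) :
    ∃ w : L, ‖w‖ = 1 ∧ φ (rankOne ℂ z z) = rankOne ℂ w w ∧ ∀ s ∈ S', rankOne ℂ s w ∈ B := by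
  set p := rankOne ℂ z z with hp
  have hz0 : z ≠ 0 := fun h => by simp [h] at hz
  have hpp : p * p = p := by simp [hp, mul_rankOne, hz]
  have hps : star p = p := star_rankOne z z
  have hPne : φ p ≠ 0 := by
    intro h
    have h1 : φ 0 = 0 := by simpa using hφ.map_smul 0 p hzA
    have h2 : p = 0 := by
      rw [← hφ.left_inv p hzA, h, ← h1, hφ.left_inv 0 (zero_mem A)]
    simp [hp, hz0] at h2
  have hPP : φ p * φ p = φ p := by rw [← hφ.map_mul p hzA p hzA, hpp]
  have hPs : star (φ p) = φ p := by rw [← hφ.map_star p hzA, hps]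
  obtain ⟨s, hs, hsne⟩ : ∃ s ∈ S', φ p s ≠ 0 := by
    by_contra! h
    exact hPne (eq_zero_of_forall_dense_span hS' h)
  set k : L := φ p s with hk
  have hPk : φ p k = k := by
    rw [hk, ← mul_apply_eq_comp, hPP]
  have hsB := hB s hs s hs
  set b := ψ (rankOne ℂ s s) with hb
  have hbA : b ∈ A := hψ.map_mem _ hsB
  have hφb : φ b = rankOne ℂ s s := hψ.left_inv _ hsB
  -- minimality of `p`: the corner `p A p` consists of multiples of `p`
  have hpbp : p * b * p = (inner ℂ z (b z)) • p := by
    ext x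
    simp [hp, smul_smul, mul_comm]
  have hkk : rankOne ℂ k k = (inner ℂ z (b z)) • φ p := by
    rw [← hφ.map_smul _ _ hzA, ← hpbp, hφ.map_mul _ (mul_mem hzA hbA) _ hzA,
      hφ.map_mul _ hzA _ hbA, hφb, mul_rankOne, rankOne_mul, hPs]
  set w : L := (‖k‖ : ℂ)⁻¹ • k with hw
  have hwn : ‖w‖ = 1 := by
    rw [hw, norm_smul]
    simp [hsne]
  have hPw : φ p w = w := by rw [hw, _root_.map_smul, hPk]
  refine ⟨w, hwn, ?_, fun t ht => ?_⟩
  · obtain ⟨μ, hμ⟩ : ∃ μ : ℂ, rankOne ℂ w w = μ • φ p := by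
      refine ⟨(‖k‖ : ℂ)⁻¹ * (‖k‖ : ℂ)⁻¹ * inner ℂ z (b z), ?_⟩
      rw [mul_smul, ← hkk, hw]
      simp [smul_smul]
    have h1 : w = μ • w := by
      have := congrArg (fun T : L →L[ℂ] L => T w) hμ
      simpa [hwn, hPw] using this
    have hw0 : w ≠ 0 := fun h => by simp [h] at hwn
    have h2 : μ = 1 := by
      have : (μ - 1) • w = 0 := by rw [sub_smul, ← h1, one_smul, sub_self]
      rcases smul_eq_zero.1 this with h | h
      · exact sub_eq_zero.1 h
      · exact absurd h hw0
    rw [hμ, h2, one_smul]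
  · have h1 : rankOne ℂ t k ∈ B := by
      have := mul_mem (hB t ht s hs) (hφ.map_mem p hzA)
      rwa [rankOne_mul, hPs] at this
    have h2 : rankOne ℂ t w = (‖k‖ : ℂ)⁻¹ • rankOne ℂ t k := by
      rw [hw]; simp
    rw [h2]
    exact B.smul_mem' _ h1

theorem IsStarIsoOn.map_rankOne (hφ : IsStarIsoOn A B φ ψ) {x z : K} {w : L} (hz : ‖z‖ = 1)
    (hzA : rankOne ℂ z z ∈ A) (hzw : φ (rankOne ℂ z z) = rankOne ℂ w w)
    (hx : rankOne ℂ x z ∈ A) :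
    φ (rankOne ℂ x z) = rankOne ℂ (φ (rankOne ℂ x z) w) w := by
  have h1 : rankOne ℂ x z = rankOne ℂ x z * rankOne ℂ z z := by simp [mul_rankOne, hz]
  conv_lhs => rw [h1, hφ.map_mul _ hx _ hzA, hzw, mul_rankOne]

theorem IsStarIsoOn.norm_map_rankOne_apply (hφ : IsStarIsoOn A B φ ψ) {x z : K} {w : L}
    (hw : ‖w‖ = 1) (hzA : rankOne ℂ z z ∈ A)
    (hzw : φ (rankOne ℂ z z) = rankOne ℂ w w) (hx : rankOne ℂ x z ∈ A) :
    ‖φ (rankOne ℂ x z) w‖ = ‖x‖ := by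
  have h1 : star (rankOne ℂ x z) * rankOne ℂ x z = ((‖x‖ : ℂ) ^ 2) • rankOne ℂ z z := by
    rw [star_rankOne, mul_rankOne]
    simp [inner_self_eq_norm_sq_to_K]
  have h2 : star (φ (rankOne ℂ x z)) * φ (rankOne ℂ x z) = ((‖x‖ : ℂ) ^ 2) • rankOne ℂ w w := by
    rw [← hφ.map_star _ hx, ← hφ.map_mul _ (star_mem hx) _ hx, h1, hφ.map_smul _ _ hzA, hzw]
  have h3 : inner ℂ (φ (rankOne ℂ x z) w) (φ (rankOne ℂ x z) w) = (‖x‖ : ℂ) ^ 2 := by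
    rw [← ContinuousLinearMap.adjoint_inner_right, ← ContinuousLinearMap.star_eq_adjoint,
      ← mul_apply_eq_comp, h2]
    simp [hw, inner_smul_right]
  rw [inner_self_eq_norm_sq_to_K] at h3
  have h4 : ‖φ (rankOne ℂ x z) w‖ ^ 2 = ‖x‖ ^ 2 := Complex.ofReal_injective (by simpa using h3)
  exact (pow_left_inj₀ (norm_nonneg _) (norm_nonneg _) two_ne_zero).1 h4

/-- A `*`-isomorphism between two `*`-algebras of operators, each containing sufficiently many
rank one operators, is implemented by a unitary. If `φ` maps the rank one projection onto `z` to
the one onto `w`, then the unitary is determined by `x ↦ φ (x ⊗ z*) w`. -/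
theorem IsStarIsoOn.exists_unitary (hφ : IsStarIsoOn A B φ ψ) (hψ : IsStarIsoOn B A ψ φ)
    {S : Set K} (hS : Dense (Submodule.span ℂ S : Set K))
    (hA : ∀ s ∈ S, ∀ t ∈ S, rankOne ℂ s t ∈ A)
    {S' : Set L} (hS' : Dense (Submodule.span ℂ S' : Set L))
    (hB : ∀ s ∈ S', ∀ t ∈ S', rankOne ℂ s t ∈ B) {z : K} (hzS : z ∈ S) (hz : ‖z‖ = 1) :
    ∃ U : K ≃ₗᵢ[ℂ] L, ∀ T ∈ A, ∀ x : K, U (T x) = φ T (U x) := by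
  have hzA := hA z hzS z hzS
  obtain ⟨w, hw, hzw, hwB⟩ := hφ.exists_map_rankOne_eq_rankOne hψ hS' hB hz hzA
  have hwA : rankOne ℂ w w ∈ B := hzw ▸ hφ.map_mem _ hzA
  have hwz : ψ (rankOne ℂ w w) = rankOne ℂ z z := by rw [← hzw, hφ.left_inv _ hzA]
  let f : rankOneVectors A z ≃ₗ[ℂ] rankOneVectors B w :=
    { toFun := fun x => ⟨φ (rankOne ℂ (x : K) z) w, by
        rw [mem_rankOneVectors, ← hφ.map_rankOne hz hzA hzw x.2]; exact hφ.map_mem _ x.2⟩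
      invFun := fun y => ⟨ψ (rankOne ℂ (y : L) w) z, by
        rw [mem_rankOneVectors, ← hψ.map_rankOne hw hwA hwz y.2]; exact hψ.map_mem _ y.2⟩
      map_add' := fun x y => Subtype.ext <| by
        simp [hφ.map_add _ x.2 _ y.2]
      map_smul' := fun c x => Subtype.ext <| by
        simp [hφ.map_smul c _ x.2]
      left_inv := fun x => Subtype.ext <| by
        dsimp only
        rw [← hφ.map_rankOne hz hzA hzw x.2, hφ.left_inv _ x.2]
        simp [hz]
      right_inv := fun y => Subtype.ext <| by
        dsimp only
        rw [← hψ.map_rankOne hw hwA hwz y.2, hψ.left_inv _ y.2]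
        simp [hw] }
  have hf : ∀ x : rankOneVectors A z, (f x : L) = φ (rankOne ℂ (x : K) z) w := fun _ => rfl
  have hnorm : ∀ x : rankOneVectors A z, ‖(f x : L)‖ = ‖(x : K)‖ := fun x =>
    hφ.norm_map_rankOne_apply hw hzA hzw x.2
  have hd : Dense (rankOneVectors A z : Set K) :=
    hS.mono (Submodule.span_le.2 fun s hs => hA s hs z hzS)
  have hd' : Dense (rankOneVectors B w : Set L) :=
    hS'.mono (Submodule.span_le.2 fun s hs => hwB s hs)
  have hdr : DenseRange (rankOneVectors A z).subtype := by
    simpa [DenseRange] using hd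
  have hdr' : DenseRange (rankOneVectors B w).subtype := by
    simpa [DenseRange] using hd'
  let U : K ≃ₗᵢ[ℂ] L := f.extendOfIsometry (rankOneVectors A z).subtype
    (rankOneVectors B w).subtype hdr hdr' hnorm
  have hU : ∀ x : rankOneVectors A z, U x = f x := fun x =>
    LinearEquiv.extendOfIsometry_eq f _ _ hdr hdr' hnorm x
  refine ⟨U, fun T hT x => ?_⟩
  refine hd.induction (fun x hx => ?_) (isClosed_eq (by fun_prop) (by fun_prop)) x
  have hTx : T x ∈ rankOneVectors A z := by
    rw [mem_rankOneVectors, ← mul_rankOne]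
    exact mul_mem hT hx
  rw [hU ⟨_, hTx⟩, hU ⟨x, hx⟩, hf, hf]
  dsimp only
  rw [← mul_rankOne, hφ.map_mul _ hT _ hx, mul_apply_eq_comp]

end IsStarIsoOn

end Implementation

/-! ### Vectors supported at a point -/

section PointMass

variable {X H : Type*} [NormedAddCommGroup H]

theorem hasSum_norm_sq (f : L2Fun X H) : HasSum (fun x => ‖f x‖ ^ 2) (‖f‖ ^ 2) := by
  have := lp.hasSum_norm (p := 2) (by norm_num) f
  simpa using this

open Classical in
/-- The vector `δ_x ⊗ a` of `ℓ²(X, H)`. -/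
noncomputable def pointMass (x : X) (a : H) : L2Fun X H := lp.single 2 x a

@[simp]
theorem pointMass_apply_self (x : X) (a : H) : pointMass x a x = a := by
  classical exact lp.single_apply_self (E := fun _ : X => H) 2 x a

theorem pointMass_apply_of_ne {x y : X} (h : y ≠ x) (a : H) : pointMass x a y = 0 := by
  classical exact lp.single_apply_ne (E := fun _ : X => H) 2 x a h

@[simp]
theorem norm_pointMass (x : X) (a : H) : ‖pointMass x a‖ = ‖a‖ := by
  classical exact lp.norm_single (E := fun _ : X => H) (p := 2) (by norm_num) x a

variable [InnerProductSpace ℂ H]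

theorem inner_pointMass_left (x : X) (a : H) (f : L2Fun X H) :
    inner ℂ (pointMass x a) f = inner ℂ a (f x) := by
  classical exact lp.inner_single_left (𝕜 := ℂ) (G := fun _ : X => H) x a f

theorem inner_pointMass_right (x : X) (a : H) (f : L2Fun X H) :
    inner ℂ f (pointMass x a) = inner ℂ (f x) a := by
  classical exact lp.inner_single_right (𝕜 := ℂ) (G := fun _ : X => H) x a f

theorem entry_apply (T : L2Fun X H →L[ℂ] L2Fun X H) (x y : X) (v : H) :
    RoeAlgebra.entry T x y v = T (pointMass y v) x := rfl

theorem dense_span_pointMass :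
    Dense (Submodule.span ℂ {f : L2Fun X H | ∃ x a, f = pointMass x a} : Set (L2Fun X H)) := by
  classical
  intro f
  have h : HasSum (fun x => pointMass x (f x)) f := lp.hasSum_single (p := 2) (by simp) f
  refine mem_closure_of_tendsto h (Filter.Eventually.of_forall fun s => ?_)
  exact Submodule.sum_mem _ fun x _ => Submodule.subset_span ⟨x, f x, rfl⟩

theorem apply_pointMass_eq_zero {T : L2Fun X H →L[ℂ] L2Fun X H} {x y : X}
    (h : RoeAlgebra.entry T x y = 0) (v : H) : T (pointMass y v) x = 0 := by
  rw [← entry_apply, h]; rfl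

theorem apply_mem_of_entries {T : L2Fun X H →L[ℂ] L2Fun X H} {V : Submodule ℂ H}
    [FiniteDimensional ℂ V] (h : ∀ x y, RoeAlgebra.MemB V (RoeAlgebra.entry T x y))
    (f : L2Fun X H) (x : X) : T f x ∈ V := by
  classical
  have h1 : HasSum (fun y => pointMass y (f y)) f := lp.hasSum_single (p := 2) (by simp) f
  have h2 : HasSum (fun y => RoeAlgebra.entry T x y (f y)) (T f x) :=
    h1.mapL ((lp.evalCLM ℂ (fun _ : X => H) 2 x) ∘L T)
  refine (Submodule.closed_of_finiteDimensional V).mem_of_tendsto h2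
    (Filter.Eventually.of_forall fun s => Submodule.sum_mem _ fun y _ => (h x y).apply_mem _)

end PointMass

/-! ### Band operators -/

section BandOperators

variable {X H : Type*} [NormedAddCommGroup H] [InnerProductSpace ℂ H]

open Classical in
/-- If the fibres of `π : I → X` have at most `N` points, then taking the coefficients
`⟨b, f (π i)⟩` for `i ∈ A` is a bounded operator from `ℓ²(X, H)` to `ℓ²(I)`. -/
theorem exists_coefficientOperator {I : Type*} (π : I → X) (N : ℕ)
    (hN : ∀ (x : X) (s : Finset I), (∀ i ∈ s, π i = x) → s.card ≤ N) (b : H) (A : Set I) :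
    ∃ V : L2Fun X H →L[ℂ] L2Fun I ℂ,
      ∀ f i, V f i = A.indicator (fun i => inner ℂ b (f (π i))) i := by
  have key : ∀ (f : L2Fun X H) (s : Finset I),
      ∑ i ∈ s, ‖A.indicator (fun i => inner ℂ b (f (π i))) i‖ ^ 2
        ≤ (Real.sqrt N * ‖b‖ * ‖f‖) ^ 2 := by
    intro f s
    have hsum : ∑ x ∈ s.image π, ‖f x‖ ^ 2 ≤ ‖f‖ ^ 2 :=
      sum_le_hasSum _ (fun _ _ => by positivity) (hasSum_norm_sq f)
    calc ∑ i ∈ s, ‖A.indicator (fun i => inner ℂ b (f (π i))) i‖ ^ 2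
        ≤ ∑ i ∈ s, ‖b‖ ^ 2 * ‖f (π i)‖ ^ 2 := by
          refine Finset.sum_le_sum fun i _ => ?_
          rw [← mul_pow]
          gcongr
          exact (norm_indicator_le_norm_self _ _).trans (norm_inner_le_norm _ _)
      _ = ‖b‖ ^ 2 * ∑ x ∈ s.image π, (s.filter fun i => π i = x).card • ‖f x‖ ^ 2 := by
          rw [← Finset.mul_sum, Finset.sum_comp (fun x => ‖f x‖ ^ 2) π]
      _ ≤ ‖b‖ ^ 2 * ∑ x ∈ s.image π, N • ‖f x‖ ^ 2 := by
          gcongr with x hx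
          exact hN x _ fun i hi => (Finset.mem_filter.1 hi).2
      _ = ‖b‖ ^ 2 * (N * ∑ x ∈ s.image π, ‖f x‖ ^ 2) := by
          simp only [nsmul_eq_mul, Finset.mul_sum]
      _ ≤ ‖b‖ ^ 2 * (N * ‖f‖ ^ 2) := by gcongr
      _ = (Real.sqrt N * ‖b‖ * ‖f‖) ^ 2 := by
          rw [mul_pow, mul_pow, Real.sq_sqrt (Nat.cast_nonneg N)]; ring
  let V₀ : L2Fun X H →ₗ[ℂ] L2Fun I ℂ :=
    { toFun := fun f => ⟨A.indicator (fun i => inner ℂ b (f (π i))),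
        memℓp_gen' (p := 2) (C := (Real.sqrt N * ‖b‖ * ‖f‖) ^ 2) fun s => by
          simpa using key f s⟩
      map_add' := fun f g => by
        ext i
        change A.indicator (fun i => inner ℂ b (f (π i) + g (π i))) i =
          A.indicator (fun i => inner ℂ b (f (π i))) i +
          A.indicator (fun i => inner ℂ b (g (π i))) i
        by_cases hi : i ∈ A <;> simp [hi]
      map_smul' := fun c f => by
        ext i
        change A.indicator (fun i => inner ℂ b (c • f (π i))) i =
          c * A.indicator (fun i => inner ℂ b (f (π i))) i
        by_cases hi : i ∈ A <;> simp [hi] }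
  refine ⟨V₀.mkContinuous (Real.sqrt N * ‖b‖) fun f => ?_, fun f i => rfl⟩
  refine lp.norm_le_of_forall_sum_le (p := 2) (by norm_num) (by positivity) fun s => ?_
  have hV : ∀ i, V₀ f i = A.indicator (fun i => inner ℂ b (f (π i))) i := fun _ => rfl
  simpa [hV] using key f s

variable [MetricSpace X] [CompleteSpace H]

/-- For a set `A` of pairs of points at distance at most `R`, the operator
`∑ (x, y) ∈ A, (δ_x ⊗ a) (δ_y ⊗ b)*` is well defined and belongs to `ℂ_s[X]`. -/
theorem exists_bandOperator (hX : BoundedGeometry X) {R : ℝ} (hR : 0 ≤ R) (a b : H) :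
    ∃ T : Set {p : X × X // dist p.1 p.2 ≤ R} → (L2Fun X H →L[ℂ] L2Fun X H),
      (∀ A, T A ∈ algStableUniformRoe X H) ∧
      ∀ f g : L2Fun X H,
        Summable (fun p : {p : X × X // dist p.1 p.2 ≤ R} =>
          inner ℂ (g p.1.1) a * inner ℂ b (f p.1.2)) ∧
        ∀ A, inner ℂ g (T A f) =
          ∑' p, A.indicator (fun p => inner ℂ (g p.1.1) a * inner ℂ b (f p.1.2)) p := by
  classical
  obtain ⟨N, hN⟩ := hX R hR
  have hball : ∀ (x : X) (t : Finset X), (∀ y ∈ t, dist y x ≤ R) → t.card ≤ N := by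
    intro x t ht
    have h1 : (t : Set X).encard ≤ (Metric.closedBall x R).encard :=
      Set.encard_le_encard fun y hy => Metric.mem_closedBall.2 (ht y hy)
    have h2 := h1.trans (hN x)
    rw [Set.encard_coe_eq_coe_finsetCard] at h2
    exact_mod_cast h2
  have hfst : ∀ (x : X) (s : Finset {p : X × X // dist p.1 p.2 ≤ R}),
      (∀ p ∈ s, p.1.1 = x) → s.card ≤ N := by
    intro x s hs
    have hinj : Set.InjOn (fun p : {p : X × X // dist p.1 p.2 ≤ R} => p.1.2) s := by
      intro p hp q hq h
      exact Subtype.ext (Prod.ext ((hs p hp).trans (hs q hq).symm) h)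
    rw [← Finset.card_image_of_injOn hinj]
    refine hball x _ fun y hy => ?_
    obtain ⟨p, hp, rfl⟩ := Finset.mem_image.1 hy
    rw [← hs p hp, dist_comm]
    exact p.2
  have hsnd : ∀ (x : X) (s : Finset {p : X × X // dist p.1 p.2 ≤ R}),
      (∀ p ∈ s, p.1.2 = x) → s.card ≤ N := by
    intro x s hs
    have hinj : Set.InjOn (fun p : {p : X × X // dist p.1 p.2 ≤ R} => p.1.1) s := by
      intro p hp q hq h
      exact Subtype.ext (Prod.ext h ((hs p hp).trans (hs q hq).symm))
    rw [← Finset.card_image_of_injOn hinj]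
    refine hball x _ fun y hy => ?_
    obtain ⟨p, hp, rfl⟩ := Finset.mem_image.1 hy
    rw [← hs p hp]
    exact p.2
  obtain ⟨P, hP⟩ := exists_coefficientOperator
    (fun p : {p : X × X // dist p.1 p.2 ≤ R} => p.1.1) N hfst a Set.univ
  choose Q hQ using exists_coefficientOperator
    (fun p : {p : X × X // dist p.1 p.2 ≤ R} => p.1.2) N hsnd b
  have hinner : ∀ (A) (f g : L2Fun X H), HasSum
      (A.indicator fun p : {p : X × X // dist p.1 p.2 ≤ R} =>
        inner ℂ (g p.1.1) a * inner ℂ b (f p.1.2))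
      (inner ℂ g ((ContinuousLinearMap.adjoint P ∘L Q A) f)) := by
    intro A f g
    rw [ContinuousLinearMap.comp_apply, ContinuousLinearMap.adjoint_inner_right]
    have h : (A.indicator fun p : {p : X × X // dist p.1 p.2 ≤ R} =>
        inner ℂ (g p.1.1) a * inner ℂ b (f p.1.2)) = fun p => inner ℂ (P g p) (Q A f p) := by
      ext p
      rw [hP, hQ]
      by_cases hp : p ∈ A <;> simp [hp, mul_comm]
    rw [h]
    exact lp.hasSum_inner (𝕜 := ℂ) (P g) (Q A f)
  refine ⟨fun A => ContinuousLinearMap.adjoint P ∘L Q A, fun A => ⟨⟨R + 1, by positivity, ?_⟩,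
    Submodule.span ℂ {a, b}, FiniteDimensional.span_of_finite ℂ (Set.toFinite _), ?_⟩, fun f g =>
    ⟨by simpa using (hinner Set.univ f g).summable, fun A => (hinner A f g).tsum_eq.symm⟩⟩
  · intro x y hxy
    ext v
    refine ext_inner_left ℂ fun c => ?_
    rw [entry_apply, ← inner_pointMass_left, zero_apply, inner_zero_right]
    refine (hinner A _ _).unique ?_
    convert hasSum_zero with p
    by_cases hx : p.1.1 = x
    · have hy : p.1.2 ≠ y := by
        rintro rfl
        have := p.2
        rw [hx] at this
        linarith
      simp [pointMass_apply_of_ne hy]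
    · simp [pointMass_apply_of_ne hx]
  · intro x y
    have hfin : FiniteDimensional ℂ (Submodule.span ℂ {a, b}) :=
      FiniteDimensional.span_of_finite ℂ (Set.toFinite _)
    refine ⟨fun v _ => ?_, fun v hv => ?_⟩
    · rw [← Submodule.orthogonal_orthogonal (Submodule.span ℂ {a, b}), Submodule.mem_orthogonal]
      intro c hc
      have hca : inner ℂ c a = 0 :=
        Submodule.inner_left_of_mem_orthogonal (Submodule.subset_span (by simp)) hc
      rw [entry_apply, ← inner_pointMass_left]
      refine (hinner A _ _).unique ?_
      convert hasSum_zero with p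
      by_cases hx : p.1.1 = x
      · simp [hx, hca]
      · simp [pointMass_apply_of_ne hx]
    · have hbv : inner ℂ b v = 0 :=
        Submodule.inner_right_of_mem_orthogonal (Submodule.subset_span (by simp)) hv
      refine ext_inner_left ℂ fun c => ?_
      rw [entry_apply, ← inner_pointMass_left, inner_zero_right]
      refine (hinner A _ _).unique ?_
      convert hasSum_zero with p
      by_cases hy : p.1.2 = y
      · simp [hy, hbv]
      · simp [pointMass_apply_of_ne hy]

/-- The band operators as a family indexed by sets of pairs: it is countably additive in the weak
operator topology, and consists of finite sums of rank one operators on finite sets. -/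
theorem exists_bandFamily (hX : BoundedGeometry X) {R : ℝ} (hR : 0 ≤ R) (a b : H) :
    ∃ T : Set {p : X × X // dist p.1 p.2 ≤ R} → (L2Fun X H →L[ℂ] L2Fun X H),
      (∀ A, T A ∈ algStableUniformRoe X H) ∧
      (∀ f g : L2Fun X H, ∃ c : {p : X × X // dist p.1 p.2 ≤ R} → ℂ, Summable c ∧
        ∀ A, inner ℂ g (T A f) = ∑' p, A.indicator c p) ∧
      ∀ F : Finset {p : X × X // dist p.1 p.2 ≤ R},
        T F = ∑ p ∈ F, rankOne ℂ (pointMass p.1.1 a) (pointMass p.1.2 b) := by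
  obtain ⟨T, hT, hTi⟩ := exists_bandOperator hX hR a b
  refine ⟨T, hT, fun f g => ⟨_, (hTi f g).1, (hTi f g).2⟩, fun F => ?_⟩
  ext1 f
  refine ext_inner_left ℂ fun g => ?_
  rw [(hTi f g).2, tsum_eq_sum (s := F) fun p hp => Set.indicator_of_notMem (by simpa using hp) _,
    sum_apply, inner_sum]
  refine Finset.sum_congr rfl fun p hp => ?_
  rw [Set.indicator_of_mem (by simpa using hp), rankOne_apply, inner_smul_right,
    inner_pointMass_left, inner_pointMass_right, mul_comm]

theorem rankOne_pointMass_mem (hX : BoundedGeometry X) (x y : X) (a b : H) :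
    rankOne ℂ (pointMass x a) (pointMass y b) ∈ algStableUniformRoe X H := by
  obtain ⟨T, hT, -, hF⟩ := exists_bandFamily (H := H) hX (dist_nonneg (x := x) (y := y)) a b
  have := hF {⟨(x, y), le_rfl⟩}
  rw [Finset.sum_singleton] at this
  rw [← this]
  exact hT _

/-- The operator `1 ⊗ a a*`. -/
theorem exists_diagonalOperator (hX : BoundedGeometry X) (a : H) :
    ∃ D ∈ algStableUniformRoe X H, ∀ f x, D f x = inner ℂ a (f x) • a := by
  obtain ⟨T, hT, hTi⟩ := exists_bandOperator (H := H) hX le_rfl a a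
  refine ⟨T Set.univ, hT _, fun f x => ?_⟩
  refine ext_inner_left ℂ fun c => ?_
  rw [← inner_pointMass_left, (hTi _ _).2, tsum_eq_single ⟨(x, x), by simp⟩]
  · simp [inner_smul_right, mul_comm]
  · rintro ⟨⟨p, q⟩, hpq⟩ hne
    have hpq' : p = q := dist_le_zero.1 hpq
    subst hpq'
    have hpx : p ≠ x := by
      rintro rfl
      exact hne rfl
    simp [pointMass_apply_of_ne hpx]

end BandOperators

/-! ### Uniform quasi-locality -/

section QuasiLocality

variable {Y H : Type*} [MetricSpace Y] [NormedAddCommGroup H] [InnerProductSpace ℂ H]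

/-- The operator `S` moves vectors supported at a point `y` into the ball of radius `s` around
`y`, up to a relative error `ε`. In contrast to being approximated by operators of
propagation `s`, this is visibly a closed condition in the weak operator topology. -/
def QuasiLocal (ε s : ℝ) (S : L2Fun Y H →L[ℂ] L2Fun Y H) : Prop :=
  ∀ (y : Y) (v : H) (g : L2Fun Y H), (∀ z, dist z y < s → g z = 0) →
    ‖inner ℂ g (S (pointMass y v))‖ ≤ ε * ‖v‖ * ‖g‖

theorem QuasiLocal.mono_right {ε s s' : ℝ} {S : L2Fun Y H →L[ℂ] L2Fun Y H}
    (h : QuasiLocal ε s S) (hs : s ≤ s') : QuasiLocal ε s' S :=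
  fun y v g hg => h y v g fun z hz => hg z (hz.trans_le hs)

theorem QuasiLocal.add {ε ε' s : ℝ} {S S' : L2Fun Y H →L[ℂ] L2Fun Y H}
    (h : QuasiLocal ε s S) (h' : QuasiLocal ε' s S') : QuasiLocal (ε + ε') s (S + S') := by
  intro y v g hg
  rw [add_apply, inner_add_right, add_mul, add_mul]
  exact (norm_add_le _ _).trans (add_le_add (h y v g hg) (h' y v g hg))

theorem QuasiLocal.sub {ε ε' s : ℝ} {S S' : L2Fun Y H →L[ℂ] L2Fun Y H}
    (h : QuasiLocal ε s S) (h' : QuasiLocal ε' s S') : QuasiLocal (ε + ε') s (S - S') := by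
  intro y v g hg
  rw [sub_apply, inner_sub_right, add_mul, add_mul]
  exact (norm_sub_le _ _).trans (add_le_add (h y v g hg) (h' y v g hg))

theorem QuasiLocal.norm_apply_le {ε s : ℝ} {S : L2Fun Y H →L[ℂ] L2Fun Y H}
    (h : QuasiLocal ε s S) {y z : Y} (hyz : s ≤ dist z y) (u v : H) :
    ‖inner ℂ u (S (pointMass y v) z)‖ ≤ ε * ‖v‖ * ‖u‖ := by
  have := h y v (pointMass z u) fun w hw =>
    pointMass_apply_of_ne (by rintro rfl; exact absurd hw (not_lt.2 hyz)) u
  rwa [inner_pointMass_left, norm_pointMass] at this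

variable [CompleteSpace H]

theorem exists_mem_algStableUniformRoe_norm_sub_le {S : L2Fun Y H →L[ℂ] L2Fun Y H}
    (hS : S ∈ stableUniformRoe Y H) {ε : ℝ} (hε : 0 < ε) :
    ∃ S' ∈ algStableUniformRoe Y H, ‖S - S'‖ ≤ ε := by
  obtain ⟨S', hS', h⟩ := Metric.mem_closure_iff.1 hS ε hε
  exact ⟨S', hS', by rw [← dist_eq_norm]; exact h.le⟩

theorem exists_quasiLocal {S : L2Fun Y H →L[ℂ] L2Fun Y H} (hS : S ∈ stableUniformRoe Y H)
    {ε : ℝ} (hε : 0 < ε) : ∃ n : ℕ, QuasiLocal ε n S := by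
  obtain ⟨S', ⟨⟨s, hs, hS'⟩, -⟩, hSS'⟩ := exists_mem_algStableUniformRoe_norm_sub_le hS hε
  obtain ⟨n, hn⟩ := exists_nat_ge s
  refine ⟨n, QuasiLocal.mono_right (fun y v g hg => ?_) hn⟩
  have h0 : inner ℂ g (S' (pointMass y v)) = 0 := by
    refine (lp.hasSum_inner (𝕜 := ℂ) g (S' (pointMass y v))).unique ?_
    convert hasSum_zero with z
    rcases lt_or_ge (dist z y) s with h | h
    · rw [hg z h, inner_zero_left]
    · rw [apply_pointMass_eq_zero (hS' z y h), inner_zero_right]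
  have h1 : inner ℂ g (S (pointMass y v)) = inner ℂ g ((S - S') (pointMass y v)) := by
    rw [sub_apply, inner_sub_right, h0, sub_zero]
  rw [h1]
  calc _ ≤ ‖g‖ * ‖(S - S') (pointMass y v)‖ := norm_inner_le_norm _ _
    _ ≤ ‖g‖ * (ε * ‖v‖) := by
        gcongr
        refine ((S - S').le_opNorm _).trans ?_
        rw [norm_pointMass]
        gcongr
    _ = _ := by ring

open Classical in
/-- A family of operators in `C*_s(Y)` that is indexed by the subsets of a set, countably additive
in the weak operator topology, is uniformly quasi-local. By Baire's theorem on the compact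
space of all subsets, quasi-locality is uniform over all subsets with a prescribed intersection
with a finite set; there are only finitely many ways to change that intersection. -/
theorem exists_uniform_quasiLocal {I : Type*} {T : Set I → (L2Fun Y H →L[ℂ] L2Fun Y H)}
    (hT : ∀ A, T A ∈ stableUniformRoe Y H)
    (hsum : ∀ f g : L2Fun Y H, ∃ c : I → ℂ, Summable c ∧
      ∀ A, inner ℂ g (T A f) = ∑' i, A.indicator c i) {ε : ℝ} (hε : 0 < ε) :
    ∃ s : ℝ, 0 < s ∧ ∀ A, QuasiLocal ε s (T A) := by
  let Z : ℕ → Set (I → Bool) := fun n => {η | QuasiLocal (ε / 3) n (T {i | η i = true})}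
  have hZc : ∀ n, IsClosed (Z n) := by
    intro n
    simp only [Z, QuasiLocal, Set.ofPred_forall]
    refine isClosed_iInter fun y => isClosed_iInter fun v => isClosed_iInter fun g =>
      isClosed_iInter fun _ => isClosed_le ?_ continuous_const
    obtain ⟨c, hc, hcT⟩ := hsum (pointMass y v) g
    simp only [hcT]
    refine continuous_norm.comp (continuous_tsum (fun i => ?_) hc.norm fun i η =>
      norm_indicator_le_norm_self _ _)
    have : (fun η : I → Bool => Set.indicator {i | η i = true} c i) =
        (fun t : Bool => if t = true then c i else 0) ∘ fun η => η i := by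
      ext η
      simp [Set.indicator_apply]
    rw [this]
    exact continuous_of_discreteTopology.comp (continuous_apply i)
  have hZu : ⋃ n, Z n = Set.univ := by
    refine Set.eq_univ_of_forall fun η => Set.mem_iUnion.2 ?_
    exact exists_quasiLocal (hT _) (by positivity)
  obtain ⟨n, η₀, hη₀⟩ := nonempty_interior_of_iUnion_of_closed hZc hZu
  obtain ⟨F, u, hu, hFu⟩ := isOpen_pi_iff.1 isOpen_interior η₀ hη₀
  have hF : ∀ η : I → Bool, (∀ i ∈ F, η i = η₀ i) → QuasiLocal (ε / 3) n (T {i | η i = true}) :=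
    fun η hη => interior_subset (hFu fun i hi => by rw [hη i hi]; exact (hu i hi).2)
  choose m hm using fun G : Finset I => exists_quasiLocal (hT G) (ε := ε / 3) (by positivity)
  set M : ℕ := max n (F.powerset.sup m) + 1 with hM
  have hmM : ∀ G ⊆ F, (m G : ℝ) ≤ M := by
    intro G hG
    have h1 : m G ≤ F.powerset.sup m := Finset.le_sup (f := m) (Finset.mem_powerset.2 hG)
    exact_mod_cast (h1.trans (le_max_right _ _)).trans (Nat.le_succ _)
  have hnM : (n : ℝ) ≤ M := by exact_mod_cast (le_max_left _ _).trans (Nat.le_succ _)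
  refine ⟨M, by rw [hM]; positivity, fun A => ?_⟩
  -- `T A` differs from an operator covered by `hF` by operators on subsets of `F`
  let η : I → Bool := fun i => if i ∈ F then η₀ i else decide (i ∈ A)
  have hTA : T A = T {i | η i = true} + T (F.filter (· ∈ A) : Finset I) -
      T (F.filter (fun i => η₀ i = true) : Finset I) := by
    ext1 f
    refine ext_inner_left ℂ fun g => ?_
    obtain ⟨c, hc, hcT⟩ := hsum f g
    rw [sub_apply, add_apply, inner_sub_right, inner_add_right, hcT, hcT, hcT, hcT,
      ← (hc.indicator _).tsum_add (hc.indicator _),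
      ← ((hc.indicator _).add (hc.indicator _)).tsum_sub (hc.indicator _)]
    congr 1
    ext i
    by_cases hi : i ∈ F <;> by_cases hA : i ∈ A <;> by_cases h0 : η₀ i = true <;>
      simp [η, hi, hA, h0]
  have h3 : ε = ε / 3 + ε / 3 + ε / 3 := by ring
  rw [hTA, h3]
  refine (((hF η fun i hi => by simp [η, hi]).mono_right hnM).add
    ((hm _).mono_right (hmM _ (Finset.filter_subset _ _)))).sub
    ((hm _).mono_right (hmM _ (Finset.filter_subset _ _)))

end QuasiLocality

/-! ### Choice of signs and orthonormal expansions -/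

section Signs

/-- Signs can be chosen such that `∑ ± p y` is no longer than it would be if the vectors `p y` were
orthogonal. By the parallelogram law, the signs can be chosen one after the other. -/
theorem exists_signs_norm_sum_sq_le {ι E : Type*} [NormedAddCommGroup E] [InnerProductSpace ℂ E]
    (F : Finset ι) (p : ι → E) :
    ∃ σ : ι → ℂ, (∀ y, σ y = 1 ∨ σ y = -1) ∧
      ‖∑ y ∈ F, σ y • p y‖ ^ 2 ≤ ∑ y ∈ F, ‖p y‖ ^ 2 := by
  classical
  induction F using Finset.induction_on with
  | empty => exact ⟨fun _ => 1, fun _ => Or.inl rfl, by simp⟩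
  | insert a F ha ih =>
    obtain ⟨σ, hσ, hle⟩ := ih
    set q := ∑ y ∈ F, σ y • p y with hq
    have hpar := parallelogram_law_with_norm ℂ (p a) q
    have hupd : ∀ t : ℂ, ∑ y ∈ insert a F, Function.update σ a t y • p y = t • p a + q := by
      intro t
      rw [Finset.sum_insert ha, Function.update_self, hq]
      congr 1
      refine Finset.sum_congr rfl fun y hy => ?_
      rw [Function.update_of_ne (by rintro rfl; exact ha hy)]
    have hsgn : ∀ t : ℂ, (t = 1 ∨ t = -1) →
        ∀ y, Function.update σ a t y = 1 ∨ Function.update σ a t y = -1 := by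
      intro t ht y
      by_cases hy : y = a
      · subst hy; simpa using ht
      · simpa [hy] using hσ y
    rw [Finset.sum_insert ha]
    rcases le_total ‖p a + q‖ ‖p a - q‖ with h | h
    · refine ⟨Function.update σ a 1, hsgn 1 (Or.inl rfl), ?_⟩
      rw [hupd, one_smul]
      nlinarith [norm_nonneg (p a + q)]
    · refine ⟨Function.update σ a (-1), hsgn (-1) (Or.inr rfl), ?_⟩
      have : ‖(-1 : ℂ) • p a + q‖ = ‖p a - q‖ := by
        rw [← norm_neg]; congr 1; module
      rw [hupd, this]
      nlinarith [norm_nonneg (p a - q)]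

theorem exists_signs_sum_norm_sq_le {ι J : Type*} [Fintype J] (F : Finset ι) (p : ι → J → ℂ) :
    ∃ σ : ι → ℂ, (∀ y, σ y = 1 ∨ σ y = -1) ∧
      ∑ j, ‖∑ y ∈ F, σ y * p y j‖ ^ 2 ≤ ∑ y ∈ F, ∑ j, ‖p y j‖ ^ 2 := by
  obtain ⟨σ, hσ, h⟩ := exists_signs_norm_sum_sq_le F
    (fun y => (WithLp.toLp 2 (p y) : EuclideanSpace ℂ J))
  refine ⟨σ, hσ, ?_⟩
  simpa [EuclideanSpace.norm_sq_eq] using h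

/-- The norm of `x` is controlled by its projection to `V` and its distance to any point of `V`. -/
theorem norm_sq_le_sum_inner_add {H : Type*} [NormedAddCommGroup H] [InnerProductSpace ℂ H]
    {V : Submodule ℂ H} [FiniteDimensional ℂ V] {ι : Type*} [Fintype ι]
    (b : OrthonormalBasis ι ℂ V) (x : H) {h : H} (hh : h ∈ V) :
    ‖x‖ ^ 2 ≤ ∑ j, ‖inner ℂ (b j : H) x‖ ^ 2 + ‖x - h‖ ^ 2 := by
  have h1 : Vᗮ.orthogonalProjectionOnto x = Vᗮ.orthogonalProjectionOnto (x - h) := by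
    rw [map_sub, Submodule.orthogonalProjectionOnto_orthogonal_apply_eq_zero hh, sub_zero]
  have h2 : ‖V.orthogonalProjectionOnto x‖ ^ 2 = ∑ j, ‖inner ℂ (b j : H) x‖ ^ 2 := by
    rw [← b.sum_sq_norm_inner_right (V.orthogonalProjectionOnto x)]
    simp
  rw [Submodule.norm_sq_eq_add_norm_sq_projection x V, h1, h2]
  gcongr
  exact Submodule.norm_orthogonalProjectionOnto_apply_le _ _

end Signs

section Expansions

variable {X H : Type*} [NormedAddCommGroup H] [InnerProductSpace ℂ H]

theorem norm_sq_sum_smul_pointMass (F : Finset X) (t : X → ℂ) {w : H} (hw : ‖w‖ = 1) :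
    ‖∑ y ∈ F, t y • pointMass y w‖ ^ 2 = ∑ y ∈ F, ‖t y‖ ^ 2 := by
  classical
  have h := lp.norm_sum_single (E := fun _ : X => H) (p := 2) (by norm_num) (fun y => t y • w) F
  have h1 : ∀ y, lp.single (E := fun _ : X => H) 2 y (t y • w) = t y • pointMass y w := by
    intro y
    rw [lp.single_smul]
    congr 1
  simp only [h1] at h
  simpa [norm_smul, hw] using h

/-- A vector that is concentrated near a point `x`, and whose coefficients are close to a
finite dimensional space `V`, is essentially determined by its inner products with the vectors
`δ_z ⊗ b`, where `z` is near `x` and `b` ranges over an orthonormal basis of `V`. -/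
theorem norm_sq_le_sum_inner_pointMass (θ η : L2Fun X H) (B : Finset X)
    {V : Submodule ℂ H} [FiniteDimensional ℂ V] {J : Type*} [Fintype J]
    (b : OrthonormalBasis J ℂ V) (hη : ∀ z, η z ∈ V) {ε : ℝ} (hθη : ‖θ - η‖ ≤ ε)
    (hB : ∀ g : L2Fun X H, (∀ z ∈ B, g z = 0) → ‖inner ℂ g θ‖ ≤ 2 * ε * ‖g‖) :
    ‖θ‖ ^ 2 ≤ ∑ q : B × J, ‖inner ℂ (pointMass (q.1 : X) (b q.2 : H)) θ‖ ^ 2 + 5 * ε ^ 2 := by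
  classical
  have hε : 0 ≤ ε := (norm_nonneg _).trans hθη
  set h : L2Fun X H := ∑ z ∈ B, lp.single 2 z (θ z) with hh
  set g : L2Fun X H := θ - h with hg
  have hhz : ∀ z, h z = if z ∈ B then θ z else 0 := by
    intro z
    rw [hh, lp.coeFn_sum, Finset.sum_apply]
    simp only [lp.single_apply, Finset.sum_pi_single]
  have hgz : ∀ z, g z = if z ∈ B then 0 else θ z := by
    intro z
    rw [hg, lp.coeFn_sub, Pi.sub_apply, hhz]
    split_ifs <;> simp
  have hgh : inner ℂ g h = 0 := by
    refine (lp.hasSum_inner (𝕜 := ℂ) g h).unique ?_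
    convert hasSum_zero with z
    rw [hgz, hhz]
    split_ifs <;> simp
  have hθ : θ = g + h := by rw [hg]; abel
  have hgn : ‖g‖ ≤ 2 * ε := by
    have h1 := hB g fun z hz => by rw [hgz, if_pos hz]
    have h2 : inner ℂ g θ = (‖g‖ : ℂ) ^ 2 := by
      rw [hθ, inner_add_right, hgh, add_zero]
      exact inner_self_eq_norm_sq_to_K g
    rw [h2, norm_pow, Complex.norm_real, norm_norm] at h1
    nlinarith [norm_nonneg g]
  have hhn : ‖h‖ ^ 2 = ∑ z ∈ B, ‖θ z‖ ^ 2 := by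
    simpa using lp.norm_sum_single (E := fun _ : X => H) (p := 2) (by norm_num) (fun z => θ z) B
  have hpy : ‖θ‖ ^ 2 = ‖g‖ ^ 2 + ‖h‖ ^ 2 := by
    have := norm_add_sq_eq_norm_sq_add_norm_sq_of_inner_eq_zero (𝕜 := ℂ) g h hgh
    rw [← hθ] at this
    nlinarith
  have hsum : ∑ z ∈ B, ‖(θ - η) z‖ ^ 2 ≤ ε ^ 2 :=
    (sum_le_hasSum _ (fun _ _ => by positivity) (hasSum_norm_sq (θ - η))).trans (by gcongr)
  have hle : ∑ z ∈ B, ‖θ z‖ ^ 2 ≤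
      ∑ z ∈ B, ∑ j, ‖inner ℂ (pointMass z (b j : H)) θ‖ ^ 2 + ε ^ 2 := by
    refine le_trans (Finset.sum_le_sum fun z _ => norm_sq_le_sum_inner_add b (θ z) (hη z)) ?_
    rw [Finset.sum_add_distrib]
    simp only [inner_pointMass_left]
    gcongr
    exact hsum
  have hprod : ∑ q : B × J, ‖inner ℂ (pointMass (q.1 : X) (b q.2 : H)) θ‖ ^ 2 =
      ∑ z ∈ B, ∑ j, ‖inner ℂ (pointMass z (b j : H)) θ‖ ^ 2 := by
    rw [Fintype.sum_prod_type,
      ← Finset.sum_coe_sort B fun z => ∑ j, ‖inner ℂ (pointMass z (b j : H)) θ‖ ^ 2]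
  rw [hpy, hhn, hprod]
  nlinarith [norm_nonneg g]

end Expansions

/-! ### Conjugation by a unitary -/

section Conjugation

variable {K L : Type*} [NormedAddCommGroup K] [InnerProductSpace ℂ K]
  [NormedAddCommGroup L] [InnerProductSpace ℂ L]

/-- The operator `U T U*`, for a unitary `U`. -/
noncomputable def unitaryConj (U : K ≃ₗᵢ[ℂ] L) (T : K →L[ℂ] K) : L →L[ℂ] L :=
  (U.toContinuousLinearEquiv : K →L[ℂ] L) ∘L T ∘L (U.symm.toContinuousLinearEquiv : L →L[ℂ] K)

theorem unitaryConj_apply (U : K ≃ₗᵢ[ℂ] L) (T : K →L[ℂ] K) (x : L) :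
    unitaryConj U T x = U (T (U.symm x)) := rfl

theorem inner_map_eq_inner_symm (U : K ≃ₗᵢ[ℂ] L) (x : K) (y : L) :
    inner ℂ y (U x) = inner ℂ (U.symm y) x := by
  rw [← U.inner_map_map, U.apply_symm_apply]

theorem unitaryConj_rankOne (U : K ≃ₗᵢ[ℂ] L) (x y : K) :
    unitaryConj U (rankOne ℂ x y) = rankOne ℂ (U x) (U y) := by
  ext z
  rw [unitaryConj_apply, rankOne_apply, rankOne_apply, map_smul, ← U.inner_map_map y,
    U.apply_symm_apply]

end Conjugation

section Coarse

variable {X Y HX HY : Type*} [MetricSpace X] [MetricSpace Y]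
  [NormedAddCommGroup HX] [InnerProductSpace ℂ HX] [CompleteSpace HX]
  [NormedAddCommGroup HY] [InnerProductSpace ℂ HY] [CompleteSpace HY]

/-- Conjugation by `U` maps `ℂ_s[X]` into `C*_s(Y)`. -/
def ConjMapsInto (U : L2Fun X HX ≃ₗᵢ[ℂ] L2Fun Y HY) : Prop :=
  ∀ T ∈ algStableUniformRoe X HX, unitaryConj U T ∈ stableUniformRoe Y HY

theorem ConjMapsInto.exists_quasiLocal_sum_rankOne {U : L2Fun X HX ≃ₗᵢ[ℂ] L2Fun Y HY}
    (hU : ConjMapsInto U) (hX : BoundedGeometry X) {R : ℝ} (hR : 0 ≤ R) (a b : HX) {ε : ℝ}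
    (hε : 0 < ε) :
    ∃ s : ℝ, 0 < s ∧ ∀ F : Finset {p : X × X // dist p.1 p.2 ≤ R},
      QuasiLocal ε s (unitaryConj U
        (∑ p ∈ F, rankOne ℂ (pointMass p.1.1 a) (pointMass p.1.2 b))) := by
  obtain ⟨T, hT, hsum, hF⟩ := exists_bandFamily hX hR a b
  obtain ⟨s, hs, h⟩ := exists_uniform_quasiLocal (T := fun A => unitaryConj U (T A))
    (fun A => hU _ (hT A)) (fun f g => by
      obtain ⟨c, hc, hcT⟩ := hsum (U.symm f) (U.symm g)
      exact ⟨c, hc, fun A => by rw [unitaryConj_apply, inner_map_eq_inner_symm, hcT]⟩) hε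
  exact ⟨s, hs, fun F => by rw [← hF]; exact h _⟩

/-- If `x₁` and `x₂` are close, then so are any points at which `U (δ_{x₁} ⊗ a)` and
`U (δ_{x₂} ⊗ b)` have large coefficients. -/
theorem ConjMapsInto.exists_dist_lt {U : L2Fun X HX ≃ₗᵢ[ℂ] L2Fun Y HY}
    (hU : ConjMapsInto U) (hX : BoundedGeometry X) {R : ℝ} (hR : 0 ≤ R) (a b : HX) {c : ℝ}
    (hc : 0 < c) :
    ∃ s : ℝ, 0 < s ∧ ∀ x₁ x₂ : X, dist x₁ x₂ ≤ R → ∀ (y₁ y₂ : Y) (u₁ u₂ : HY),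
      ‖u₁‖ = 1 → ‖u₂‖ = 1 → c ≤ ‖inner ℂ u₁ (U (pointMass x₁ a) y₁)‖ →
      c ≤ ‖inner ℂ u₂ (U (pointMass x₂ b) y₂)‖ → dist y₁ y₂ < s := by
  obtain ⟨s, hs, h⟩ := hU.exists_quasiLocal_sum_rankOne hX hR a b (ε := c ^ 2 / 2) (by positivity)
  refine ⟨s, hs, fun x₁ x₂ hx y₁ y₂ u₁ u₂ hu₁ hu₂ h₁ h₂ => ?_⟩
  by_contra! hy
  have h3 := (h {⟨(x₁, x₂), hx⟩}).norm_apply_le hy u₁ u₂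
  rw [Finset.sum_singleton, unitaryConj_rankOne, rankOne_apply, lp.coeFn_smul, Pi.smul_apply,
    inner_smul_right, norm_mul, inner_pointMass_right, ← inner_conj_symm, RCLike.norm_conj,
    hu₁, hu₂] at h3
  have := mul_le_mul h₂ h₁ hc.le (norm_nonneg _)
  nlinarith

/-! ### Existence of large coefficients -/

/-- The operators `∑ y ∈ F, ± (δ_y ⊗ w) (δ_y ⊗ w)*` are conjugate to uniformly quasi-local ones. -/
theorem ConjMapsInto.exists_quasiLocal_signs {V : L2Fun Y HY ≃ₗᵢ[ℂ] L2Fun X HX}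
    (hV : ConjMapsInto V) (hY : BoundedGeometry Y) (w : HY) {ε : ℝ} (hε : 0 < ε) :
    ∃ s : ℝ, 0 < s ∧ ∀ (F : Finset Y) (σ : Y → ℂ), (∀ y, σ y = 1 ∨ σ y = -1) →
      QuasiLocal (2 * ε) s (unitaryConj V
        (∑ y ∈ F, σ y • rankOne ℂ (pointMass y w) (pointMass y w))) := by
  classical
  obtain ⟨s, hs, h⟩ := hV.exists_quasiLocal_sum_rankOne hY le_rfl w w hε
  have h' : ∀ F : Finset Y, QuasiLocal ε s (unitaryConj V
      (∑ y ∈ F, rankOne ℂ (pointMass y w) (pointMass y w))) := by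
    intro F
    have := h (F.map ⟨fun y => ⟨(y, y), by simp⟩, fun y z hyz => by simpa using hyz⟩)
    rwa [Finset.sum_map] at this
  refine ⟨s, hs, fun F σ hσ => ?_⟩
  have hsplit : unitaryConj V (∑ y ∈ F, σ y • rankOne ℂ (pointMass y w) (pointMass y w)) =
      unitaryConj V (∑ y ∈ F with σ y = 1, rankOne ℂ (pointMass y w) (pointMass y w)) -
      unitaryConj V (∑ y ∈ F with ¬ σ y = 1, rankOne ℂ (pointMass y w) (pointMass y w)) := by
    rw [← Finset.sum_filter_add_sum_filter_not F (fun y => σ y = 1)]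
    have h1 : ∑ y ∈ F with σ y = 1, σ y • rankOne ℂ (pointMass y w) (pointMass y w) =
        ∑ y ∈ F with σ y = 1, rankOne ℂ (pointMass y w) (pointMass y w) := by
      refine Finset.sum_congr rfl fun y hy => ?_
      rw [(Finset.mem_filter.1 hy).2, one_smul]
    have h2 : ∑ y ∈ F with ¬ σ y = 1, σ y • rankOne ℂ (pointMass y w) (pointMass y w) =
        -∑ y ∈ F with ¬ σ y = 1, rankOne ℂ (pointMass y w) (pointMass y w) := by
      rw [← Finset.sum_neg_distrib]
      refine Finset.sum_congr rfl fun y hy => ?_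
      rw [(hσ y).resolve_left (Finset.mem_filter.1 hy).2, neg_one_smul]
    rw [h1, h2]
    ext1 x
    simp only [unitaryConj_apply, add_apply, neg_apply, map_add, map_neg, sub_eq_add_neg]
  rw [hsplit, two_mul]
  exact (h' _).sub (h' _)

/-- If the coefficients `⟨w, U (δ_x ⊗ v) y⟩` carry a fixed proportion of the mass
of `U (δ_x ⊗ v)`, then one of them is bounded below, uniformly in `x` and `v`.

Indeed, changing the signs of these coefficients amounts to applying operators to `δ_x ⊗ v` that
are uniformly quasi-local and have almost all of their range in one finite dimensional space of
coefficients. The resulting vectors are thus close to one subspace whose dimension is bounded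
independently of `x`. If all coefficients were small, then a suitable choice of signs would
make such a vector almost orthogonal to that subspace. -/
theorem exists_coefficient_lower_bound (hX : BoundedGeometry X) (hY : BoundedGeometry Y)
    (U : L2Fun X HX ≃ₗᵢ[ℂ] L2Fun Y HY) (hU : ConjMapsInto U.symm) {w : HY} (hw : ‖w‖ = 1)
    {m : ℝ} (hm : 0 < m) :
    ∃ c : ℝ, 0 < c ∧ ∀ (x : X) (v : HX), ‖v‖ = 1 →
      m ≤ ∑' y, ‖inner ℂ w (U (pointMass x v) y)‖ ^ 2 →
      ∃ y, c ≤ ‖inner ℂ w (U (pointMass x v) y)‖ := by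
  classical
  -- with these `ε` and `c`, the vectors obtained by changing signs have squared norm at most
  -- `c ^ 2 * M + 5 * ε ^ 2 = m / 8 + m / 8`, while half of the mass is at least `m / 2`
  set ε : ℝ := Real.sqrt (m / 40) with hε
  have hεpos : 0 < ε := Real.sqrt_pos.2 (by positivity)
  have hεsq : ε ^ 2 = m / 40 := Real.sq_sqrt (by positivity)
  obtain ⟨s, hs, hql⟩ := hU.exists_quasiLocal_signs hY w hεpos
  obtain ⟨D, hD, hDapp⟩ := exists_diagonalOperator (H := HY) hY w
  obtain ⟨S, ⟨-, V, hVfin, hSV⟩, hDS⟩ :=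
    exists_mem_algStableUniformRoe_norm_sub_le (hU D hD) hεpos
  set b := stdOrthonormalBasis ℂ V
  obtain ⟨N, hN⟩ := hX s hs.le
  -- `M` bounds the dimension of `ℓ²(ball x s) ⊗ V`
  set M : ℝ := N * Module.finrank ℂ V + 1 with hM
  have hMpos : 0 < M := by positivity
  set c : ℝ := Real.sqrt (m / (8 * M)) with hc
  have hcsq : c ^ 2 = m / (8 * M) := Real.sq_sqrt (by positivity)
  refine ⟨c, Real.sqrt_pos.2 (by positivity), fun x v hv hmass => ?_⟩
  by_contra! hsmall
  set ξ := U (pointMass x v) with hξ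
  have hξn : ‖ξ‖ = 1 := by rw [hξ, U.norm_map, norm_pointMass, hv]
  set t : Y → ℂ := fun y => inner ℂ w (ξ y) with ht
  have htle : ∀ y, ‖t y‖ ^ 2 ≤ ‖ξ y‖ ^ 2 := by
    intro y
    have := norm_inner_le_norm (𝕜 := ℂ) w (ξ y)
    rw [hw, one_mul] at this
    gcongr
  have hsummable : Summable fun y => ‖t y‖ ^ 2 :=
    (hasSum_norm_sq ξ).summable.of_nonneg_of_le (fun _ => by positivity) htle
  -- finitely many coefficients carry at least half of the mass
  obtain ⟨F, hF⟩ : ∃ F : Finset Y, m / 2 < ∑ y ∈ F, ‖t y‖ ^ 2 :=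
    (hsummable.hasSum.eventually (lt_mem_nhds (lt_of_lt_of_le (by linarith) hmass))).exists
  have hF1 : ∑ y ∈ F, ‖t y‖ ^ 2 ≤ 1 := by
    refine (Finset.sum_le_sum fun y _ => htle y).trans ?_
    have := sum_le_hasSum F (fun _ _ => by positivity) (hasSum_norm_sq ξ)
    rwa [hξn, one_pow] at this
  -- the ball of radius `s` around `x`
  have hfin : (Metric.closedBall x s).Finite :=
    Set.encard_lt_top_iff.1 ((hN x).trans_lt (ENat.natCast_lt_top N))
  set B : Finset X := hfin.toFinset with hB
  have hBcard : (B.card : ℝ) ≤ N := by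
    have := hN x
    rw [← hfin.coe_toFinset, Set.encard_coe_eq_coe_finsetCard] at this
    exact_mod_cast this
  let e : B × Fin (Module.finrank ℂ V) → L2Fun X HX := fun q => pointMass (q.1 : X) (b q.2 : HX)
  have hen : ∀ q, ‖e q‖ = 1 := by
    intro q
    rw [norm_pointMass]
    exact b.orthonormal.1 q.2
  obtain ⟨σ, hσ, hle⟩ := exists_signs_sum_norm_sq_le F fun y q => t y * inner ℂ (U (e q) y) w
  have hσn : ∀ y, ‖σ y‖ = 1 := fun y => by rcases hσ y with h | h <;> simp [h]
  set ρ : L2Fun Y HY := ∑ y ∈ F, (σ y * t y) • pointMass y w with hρ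
  have hρn : ‖ρ‖ ^ 2 = ∑ y ∈ F, ‖t y‖ ^ 2 := by
    rw [hρ, norm_sq_sum_smul_pointMass F _ hw]
    simp [hσn]
  have hρle : ‖ρ‖ ≤ 1 := by
    rw [← hρn] at hF1
    nlinarith [norm_nonneg ρ]
  -- `ρ` is fixed by `D`, so `U.symm ρ` almost has coefficients in `V`
  have hDρ : D ρ = ρ := by
    ext1
    funext y
    rw [hDapp, hρ, lp.coeFn_sum, Finset.sum_apply, inner_sum, Finset.sum_smul]
    refine Finset.sum_congr rfl fun z _ => ?_
    rw [lp.coeFn_smul, Pi.smul_apply]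
    by_cases hy : y = z
    · subst hy
      simp [hw, inner_smul_right]
    · simp [pointMass_apply_of_ne hy]
  set θ : L2Fun X HX := U.symm ρ with hθ
  have hθn : ‖θ‖ = ‖ρ‖ := U.symm.norm_map ρ
  have hθS : ‖θ - S θ‖ ≤ ε := by
    have h1 : θ - S θ = (unitaryConj U.symm D - S) θ := by
      rw [sub_apply, unitaryConj_apply, LinearIsometryEquiv.symm_symm, hθ,
        U.apply_symm_apply, hDρ]
    rw [h1]
    calc _ ≤ ‖unitaryConj U.symm D - S‖ * ‖θ‖ := ContinuousLinearMap.le_opNorm _ _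
      _ ≤ ε * 1 := by rw [hθn]; gcongr
      _ = ε := mul_one ε
  have hθloc : ∀ g : L2Fun X HX, (∀ z ∈ B, g z = 0) → ‖inner ℂ g θ‖ ≤ 2 * ε * ‖g‖ := by
    intro g hg
    have h1 := hql F σ hσ x v g fun z hz =>
      hg z (hfin.mem_toFinset.2 (Metric.mem_closedBall.2 hz.le))
    have h2 : unitaryConj U.symm (∑ y ∈ F, σ y • rankOne ℂ (pointMass y w) (pointMass y w))
        (pointMass x v) = θ := by
      rw [unitaryConj_apply, LinearIsometryEquiv.symm_symm, ← hξ, hθ, hρ, sum_apply]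
      congr 1
      refine Finset.sum_congr rfl fun y _ => ?_
      rw [smul_apply, rankOne_apply, inner_pointMass_left, smul_smul]
    rwa [h2, hv, mul_one] at h1
  have hmain := norm_sq_le_sum_inner_pointMass θ (S θ) B b (apply_mem_of_entries hSV θ) hθS hθloc
  have hcoef : ∀ q, inner ℂ (e q) θ = ∑ y ∈ F, σ y * (t y * inner ℂ (U (e q) y) w) := by
    intro q
    rw [hθ, inner_map_eq_inner_symm, LinearIsometryEquiv.symm_symm, hρ, inner_sum]
    refine Finset.sum_congr rfl fun y _ => ?_
    rw [inner_smul_right, inner_pointMass_right, mul_assoc]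
  have hbound : ∑ y ∈ F, ∑ q, ‖t y * inner ℂ (U (e q) y) w‖ ^ 2 ≤ c ^ 2 * M := by
    calc ∑ y ∈ F, ∑ q, ‖t y * inner ℂ (U (e q) y) w‖ ^ 2
        ≤ ∑ y ∈ F, ∑ q, c ^ 2 * ‖U (e q) y‖ ^ 2 := by
          gcongr with y _ q _
          rw [← mul_pow, norm_mul]
          have h1 := norm_inner_le_norm (𝕜 := ℂ) (U (e q) y) w
          rw [hw, mul_one] at h1
          have h2 := (hsmall y).le
          gcongr
      _ = c ^ 2 * ∑ q, ∑ y ∈ F, ‖U (e q) y‖ ^ 2 := by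
          rw [Finset.sum_comm, Finset.mul_sum]
          simp only [Finset.mul_sum]
      _ ≤ c ^ 2 * ∑ q : B × Fin (Module.finrank ℂ V), 1 := by
          gcongr with q _
          have := sum_le_hasSum F (fun _ _ => by positivity) (hasSum_norm_sq (U (e q)))
          rwa [U.norm_map, hen, one_pow] at this
      _ ≤ c ^ 2 * M := by
          gcongr
          simp only [Finset.sum_const, Finset.card_univ, Fintype.card_prod, Fintype.card_coe,
            Fintype.card_fin, nsmul_eq_mul, mul_one, Nat.cast_mul, hM]
          have : (B.card : ℝ) * Module.finrank ℂ V ≤ N * Module.finrank ℂ V := by gcongr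
          linarith
  have hcM : c ^ 2 * M = m / 8 := by rw [hcsq]; field_simp
  have hfinal : ∑ q, ‖inner ℂ (e q) θ‖ ^ 2 ≤ m / 8 := by
    simp only [hcoef]
    linarith
  rw [hθn, hρn, hεsq] at hmain
  change _ ≤ ∑ q, ‖inner ℂ (e q) θ‖ ^ 2 + _ at hmain
  linarith

/-- A unitary that conjugates the two algebras into each other is concentrated somewhere: for
every `x`, one of the coefficients of `U (δ_x ⊗ v)` with respect to finitely many fixed vectors
of `HY` is bounded below by a constant. -/
theorem exists_large_coefficient (hX : BoundedGeometry X) (hY : BoundedGeometry Y)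
    (U : L2Fun X HX ≃ₗᵢ[ℂ] L2Fun Y HY) (hU : ConjMapsInto U) (hU' : ConjMapsInto U.symm)
    {v : HX} (hv : ‖v‖ = 1) :
    ∃ (c : ℝ) (k : ℕ) (w : Fin k → HY), 0 < c ∧ (∀ i, ‖w i‖ = 1) ∧
      ∀ x, ∃ y i, c ≤ ‖inner ℂ (w i) (U (pointMass x v) y)‖ := by
  obtain ⟨D, hD, hDapp⟩ := exists_diagonalOperator (H := HX) hX v
  obtain ⟨S, ⟨-, V, hVfin, hSV⟩, hDS⟩ :=
    exists_mem_algStableUniformRoe_norm_sub_le (hU D hD) (ε := 1 / 2) (by norm_num)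
  set b := stdOrthonormalBasis ℂ V
  set k := Module.finrank ℂ V with hk
  have hbn : ∀ i, ‖(b i : HY)‖ = 1 := fun i => b.orthonormal.1 i
  choose c hc hclow using fun i => exists_coefficient_lower_bound hX hY U hU' (hbn i)
    (m := 3 / (4 * (k + 1))) (by positivity)
  obtain ⟨c₀, hc₀, hc₀pos⟩ : ∃ c₀ : ℝ, (∀ i, c₀ ≤ c i) ∧ 0 < c₀ := by
    have h1 : ∀ᶠ t : ℝ in nhdsWithin 0 (Set.Ioi 0), ∀ i, t ≤ c i :=
      Filter.eventually_all.2 fun i => by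
        filter_upwards [Ioc_mem_nhdsGT (hc i)] with t ht using ht.2
    exact (h1.and self_mem_nhdsWithin).exists
  refine ⟨c₀, k, fun i => b i, hc₀pos, hbn, fun x => ?_⟩
  set ξ := U (pointMass x v) with hξ
  have hξn : ‖ξ‖ = 1 := by rw [hξ, U.norm_map, norm_pointMass, hv]
  have hDξ : unitaryConj U D ξ = ξ := by
    rw [unitaryConj_apply, hξ, U.symm_apply_apply]
    congr 1
    ext1
    funext z
    rw [hDapp]
    by_cases hz : z = x
    · subst hz; simp [hv]
    · simp [pointMass_apply_of_ne hz]
  have hξS : ‖ξ - S ξ‖ ≤ 1 / 2 := by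
    have h1 : ξ - S ξ = (unitaryConj U D - S) ξ := by rw [sub_apply, hDξ]
    rw [h1]
    calc _ ≤ ‖unitaryConj U D - S‖ * ‖ξ‖ := ContinuousLinearMap.le_opNorm _ _
      _ ≤ 1 / 2 := by rw [hξn, mul_one]; exact hDS
  have hsum : ∀ i, Summable fun y => ‖inner ℂ (b i : HY) (ξ y)‖ ^ 2 := by
    intro i
    refine (hasSum_norm_sq ξ).summable.of_nonneg_of_le (fun _ => by positivity) fun y => ?_
    have := norm_inner_le_norm (𝕜 := ℂ) (b i : HY) (ξ y)
    rw [hbn, one_mul] at this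
    gcongr
  have hmass : (1 : ℝ) ≤ ∑ i, ∑' y, ‖inner ℂ (b i : HY) (ξ y)‖ ^ 2 + ‖ξ - S ξ‖ ^ 2 := by
    have h1 := (hasSum_sum (s := Finset.univ) fun i _ => (hsum i).hasSum).add
      (hasSum_norm_sq (ξ - S ξ))
    have h2 := hasSum_le (fun y => norm_sq_le_sum_inner_add b (ξ y)
      (apply_mem_of_entries hSV ξ y)) (hasSum_norm_sq ξ) h1
    rwa [hξn, one_pow] at h2
  -- one of the `k` families of coefficients carries its share of the mass `1 - (1 / 2) ^ 2`
  obtain ⟨i, hi⟩ : ∃ i, 3 / (4 * ((k : ℝ) + 1)) ≤ ∑' y, ‖inner ℂ (b i : HY) (ξ y)‖ ^ 2 := by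
    by_contra! hlt
    have h1 : ∑ i, ∑' y, ‖inner ℂ (b i : HY) (ξ y)‖ ^ 2 ≤ k * (3 / (4 * ((k : ℝ) + 1))) := by
      refine (Finset.sum_le_sum fun i _ => (hlt i).le).trans ?_
      simp [hk]
    have h2 : k * (3 / (4 * ((k : ℝ) + 1))) < 3 / 4 := by
      rw [mul_div_assoc', div_lt_div_iff₀ (by positivity) (by norm_num)]
      linarith
    nlinarith [norm_nonneg (ξ - S ξ)]
  obtain ⟨y, hy⟩ := hclow i x v hv hi
  exact ⟨y, i, (hc₀ i).trans hy⟩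

/-! ### Construction of the coarse equivalence -/

/-- If `g` picks a place where `U* (δ_y ⊗ w)` is large, and `f` one where `U (δ_x ⊗ v)` is large,
then `g ∘ f` is close to the identity: both `x` and `g (f x)` are places where the conjugates of
operators at the point `f x` are large. -/
theorem areClose_comp_id (hY : BoundedGeometry Y)
    (U : L2Fun X HX ≃ₗᵢ[ℂ] L2Fun Y HY) (hU' : ConjMapsInto U.symm)
    {v : HX} (hv : ‖v‖ = 1) {w : HY} {k l : ℕ} {w' : Fin k → HY}
    {v' : Fin l → HX} (hv' : ∀ j, ‖v' j‖ = 1)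
    {c c' : ℝ} (hc : 0 < c) (hc' : 0 < c') {f : X → Y} {g : Y → X} {i : X → Fin k} {j : Y → Fin l}
    (hf : ∀ x, c ≤ ‖inner ℂ (w' (i x)) (U (pointMass x v) (f x))‖)
    (hg : ∀ y, c' ≤ ‖inner ℂ (v' (j y)) (U.symm (pointMass y w) (g y))‖) :
    AreClose (g ∘ f) id := by
  choose s hs h using fun a : Fin k =>
    hU'.exists_dist_lt hY le_rfl (w' a) w (c := min c c') (lt_min hc hc')
  obtain ⟨C, hC, hCpos⟩ : ∃ C : ℝ, (∀ a, s a ≤ C) ∧ 0 < C :=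
    ((Filter.eventually_all.2 fun a => Filter.eventually_ge_atTop (s a)).and
      (Filter.eventually_gt_atTop (0 : ℝ))).exists
  refine ⟨C, hCpos, fun x => ?_⟩
  have h1 : ‖inner ℂ (w' (i x)) (U (pointMass x v) (f x))‖ =
      ‖inner ℂ v (U.symm (pointMass (f x) (w' (i x))) x)‖ := by
    rw [← inner_pointMass_left, inner_map_eq_inner_symm, inner_pointMass_right,
      ← inner_conj_symm, RCLike.norm_conj]
  have h2 := h (i x) (f x) (f x) (dist_self _).le x (g (f x)) v (v' (j (f x))) hv (hv' _)
    ((min_le_left _ _).trans (h1 ▸ hf x)) ((min_le_right _ _).trans (hg _))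
  rw [dist_comm] at h2
  exact h2.le.trans (hC _)

theorem uniformlyExpansive_of_large_coefficient (hX : BoundedGeometry X)
    (U : L2Fun X HX ≃ₗᵢ[ℂ] L2Fun Y HY) (hU : ConjMapsInto U) {v : HX} {k : ℕ} {w' : Fin k → HY}
    (hw' : ∀ j, ‖w' j‖ = 1) {c : ℝ} (hc : 0 < c) {f : X → Y} {i : X → Fin k}
    (hf : ∀ x, c ≤ ‖inner ℂ (w' (i x)) (U (pointMass x v) (f x))‖) : UniformlyExpansive f := by
  intro R hR
  obtain ⟨s, hs, h⟩ := hU.exists_dist_lt hX hR.le v v hc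
  exact ⟨s, hs, fun x₁ x₂ hx => (h x₁ x₂ hx (f x₁) (f x₂) _ _ (hw' _) (hw' _) (hf x₁) (hf x₂)).le⟩

theorem coarselyEquivalent_of_unitary [Nontrivial HX] [Nontrivial HY]
    (hX : BoundedGeometry X) (hY : BoundedGeometry Y)
    (U : L2Fun X HX ≃ₗᵢ[ℂ] L2Fun Y HY) (hU : ConjMapsInto U) (hU' : ConjMapsInto U.symm) :
    CoarselyEquivalent X Y := by
  obtain ⟨v, hv⟩ := exists_norm_eq HX zero_le_one
  obtain ⟨w, hw⟩ := exists_norm_eq HY zero_le_one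
  obtain ⟨c, k, w', hc, hw', hf⟩ := exists_large_coefficient hX hY U hU hU' hv
  obtain ⟨c', l, v', hc', hv', hg⟩ := exists_large_coefficient hY hX U.symm hU' hU hw
  choose f i hf using hf
  choose g j hg using hg
  exact ⟨f, g, uniformlyExpansive_of_large_coefficient hX U hU hw' hc hf,
    uniformlyExpansive_of_large_coefficient hY U.symm hU' hv' hc' hg,
    areClose_comp_id hX U.symm hU hw hw' hc' hc hg hf,
    areClose_comp_id hY U hU' hv hv' hc hc' hf hg⟩

/-- The isomorphism only enters through the unitary that implements it, so the algebraic and the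
completed algebra, and all algebras between them, can be treated at once. -/
theorem coarselyEquivalent_of_starAlgEquiv [Nontrivial HX] [Nontrivial HY]
    (hX : BoundedGeometry X) (hY : BoundedGeometry Y)
    {A : NonUnitalStarSubalgebra ℂ (L2Fun X HX →L[ℂ] L2Fun X HX)}
    {B : NonUnitalStarSubalgebra ℂ (L2Fun Y HY →L[ℂ] L2Fun Y HY)}
    (hA : algStableUniformRoe X HX ≤ A) (hA' : A ≤ stableUniformRoe X HX)
    (hB : algStableUniformRoe Y HY ≤ B) (hB' : B ≤ stableUniformRoe Y HY)
    (Φ : A ≃⋆ₐ[ℂ] B) : CoarselyEquivalent X Y := by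
  obtain ⟨φ, ψ, hφ, hψ⟩ := exists_isStarIsoOn Φ
  obtain ⟨v, hv⟩ := exists_norm_eq HX zero_le_one
  obtain ⟨w, hw⟩ := exists_norm_eq HY zero_le_one
  rcases isEmpty_or_nonempty X with hXe | ⟨⟨x⟩⟩
  · have hYe : IsEmpty Y := by
      refine ⟨fun y => ?_⟩
      have hp := hB (rankOne_pointMass_mem hY y y w w)
      have h1 : ψ (rankOne ℂ (pointMass y w) (pointMass y w)) = ψ 0 := by
        ext f x
        exact hXe.elim x
      have h2 : rankOne ℂ (pointMass y w) (pointMass y w) = 0 := by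
        rw [← hψ.left_inv _ hp, h1, hψ.left_inv _ (zero_mem B)]
      have h3 := norm_rankOne (𝕜 := ℂ) (pointMass y w) (pointMass y w)
      rw [h2] at h3
      simp [hw] at h3
    exact ⟨hXe.elim, hYe.elim, fun R hR => ⟨1, one_pos, fun x => hXe.elim x⟩,
      fun R hR => ⟨1, one_pos, fun y => hYe.elim y⟩, ⟨1, one_pos, fun y => hYe.elim y⟩,
      ⟨1, one_pos, fun x => hXe.elim x⟩⟩
  · obtain ⟨U, hU⟩ := hφ.exists_unitary hψ dense_span_pointMass
      (by
        rintro _ ⟨x, a, rfl⟩ _ ⟨y, b, rfl⟩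
        exact hA (rankOne_pointMass_mem hX x y a b))
      dense_span_pointMass
      (by
        rintro _ ⟨x, a, rfl⟩ _ ⟨y, b, rfl⟩
        exact hB (rankOne_pointMass_mem hY x y a b))
      (z := pointMass x v) ⟨x, v, rfl⟩ (by rw [norm_pointMass, hv])
    refine coarselyEquivalent_of_unitary hX hY U (fun T hT => ?_) fun T hT => ?_
    · have h1 : unitaryConj U T = φ T := by
        ext1 f
        rw [unitaryConj_apply, hU T (hA hT), U.apply_symm_apply]
      rw [h1]
      exact hB' (hφ.map_mem _ (hA hT))
    · have h1 : unitaryConj U.symm T = ψ T := by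
        ext1 f
        rw [unitaryConj_apply, LinearIsometryEquiv.symm_symm, U.symm_apply_eq,
          hU _ (hψ.map_mem T (hB hT)), hψ.left_inv T (hB hT)]
      rw [h1]
      exact hA' (hψ.map_mem _ (hB hT))

end Coarse

theorem mainTheorem3
    {X Y : Type*} [MetricSpace X] [MetricSpace Y]
    (hX : BoundedGeometry X) (hY : BoundedGeometry Y)
    {HX HY : Type*}
    [NormedAddCommGroup HX] [InnerProductSpace ℂ HX] [CompleteSpace HX]
    [TopologicalSpace.SeparableSpace HX] (hHX : ¬ FiniteDimensional ℂ HX)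
    [NormedAddCommGroup HY] [InnerProductSpace ℂ HY] [CompleteSpace HY]
    [TopologicalSpace.SeparableSpace HY] (hHY : ¬ FiniteDimensional ℂ HY) :
    (PropertyA X → PropertyA Y →
      Nonempty (stableUniformRoe X HX ≃⋆ₐ[ℂ] stableUniformRoe Y HY) →
        CoarselyEquivalent X Y) ∧
    (Nonempty (algStableUniformRoe X HX ≃⋆ₐ[ℂ] algStableUniformRoe Y HY) →
      CoarselyEquivalent X Y) := by
  have hX' : Nontrivial HX := not_subsingleton_iff_nontrivial.1 fun _ => hHX inferInstance
  have hY' : Nontrivial HY := not_subsingleton_iff_nontrivial.1 fun _ => hHY inferInstance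
  have hXle : algStableUniformRoe X HX ≤ stableUniformRoe X HX :=
    NonUnitalStarSubalgebra.le_topologicalClosure _
  have hYle : algStableUniformRoe Y HY ≤ stableUniformRoe Y HY :=
    NonUnitalStarSubalgebra.le_topologicalClosure _
  refine ⟨fun _ _ ⟨Φ⟩ => ?_, fun ⟨Φ⟩ => ?_⟩
  · exact coarselyEquivalent_of_starAlgEquiv hX hY hXle le_rfl hYle le_rfl Φ
  · exact coarselyEquivalent_of_starAlgEquiv hX hY le_rfl hXle le_rfl hYle Φ
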